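/- **Setting.** Let $\phi(x;\theta)\in\mathbb R^d$ and $\psi(y;\theta)\in\mathbb R^d$ be encoders with parameter $\theta\in\mathbb R^p$ such that $\psi(\cdot\,;\theta)$ is measurable. Let $\mathcal D_{\rm pos}$ be a probability distribution of positive pairs $(x,y)$ on $\mathbf D_X\times\mathbf D_Y$ whose marginal in $x$ has finite support $\{x_1,\dots,x_m\}$ of size $m$; for each $x$ in this support let $\mathbf D_{\rm neg}(x)\subseteq\mathbf D_Y$ be a set of $m_{\rm neg}$ elements. Let $\beta>0$, let $B,R\ge 1$ and $0\le P<R$ be integers, and put $$\mathcal L(\theta)=\mathbb E_{(x,y)\sim\mathcal D_{\rm pos}}\Big[-\log\frac{\exp(\beta\,\phi(x;\theta)^\top\psi(y;\theta))}{\sum_{z\in\mathbf D_{\rm neg}(x)}\exp(\beta\,\phi(x;\theta)^\top\psi(z;\theta))}\Big],\qquad p_{x,\theta}(z)=\frac{\exp(\beta\,\phi(x;\theta)^\top\psi(z;\theta))}{\sum_{z'\in\mathbf D_{\rm neg}(x)}\exp(\beta\,\phi(x;\theta)^\top\psi(z';\theta))},$$ $H(x,y;\theta)=\nabla_\theta[\phi(x;\theta)^\top\psi(y;\theta)]$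 (assumed to exist). **Assumptions.** There are $c>0$ and $L_P,L_H,\sigma\ge0$ such that for all $\theta,\theta'\in\mathbb R^p$, all $x$ in the support of the marginal, all $y\in\mathbf D_Y$ and all $z\in\mathbf D_{\rm neg}(x)$: (1) $\|\phi(x;\theta)\|\le c$ and $\|\psi(y;\theta)\|\le c$; (2) $|\phi(x;\theta)^\top\psi(z;\theta)-\phi(x;\theta')^\top\psi(z;\theta')|\le L_P\|\theta-\theta'\|$; (3) $\|H(x,y;\theta)-H(x,y;\theta')\|\le L_H\|\theta-\theta'\|$; (4) $\|H(x',y';\theta)-\mathbb E_{\mathcal D_{\rm pos}}[H(x',y';\theta)]\|\le\sigma$ for $\mathcal D_{\rm pos}$-almost every $(x',y')$, and $\|H(x,z;\theta)-\mathbb E_{(x',y')\sim\mathcal D_{\rm pos},\,z'\sim p_{x',\theta}}[H(x',z';\theta)]\|\le\sigma$. **Algorithm (EMC$^2$).** Start from a (possibly random) parameter $\theta_0$ and chain states $Z_i\in\mathbf D_{\rm neg}(x_i)$, $i\in[m]$. In iteration $t=0,1,\dots$ draw $B$ independent pairs $(x_{i_k},y_{i_k})\sim\mathcal D_{\rm pos}$.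 For $k=1,\dots,B$ in turn and $r=0,\dots,R-1$, draw $Z'$ uniformly from $\mathbf D_{\rm neg}(x_{i_k})$, replace $Z_{i_k}$ by $Z'$ with probability $\min\{1,p_{x_{i_k},\theta_t}(Z')/p_{x_{i_k},\theta_t}(Z_{i_k})\}$ (otherwise keep it), and let $\tilde Z^{(r)}_k$ be the resulting value of $Z_{i_k}$. Then, with constant step size $\gamma>0$, set $$\theta_{t+1}=\theta_t-\gamma\Big(-\frac{\beta}{B}\sum_{k=1}^BH(x_{i_k},y_{i_k};\theta_t)+\frac{\beta}{B(R-P)}\sum_{k=1}^B\sum_{r=P}^{R-1}H(x_{i_k},\tilde Z_k^{(r)};\theta_t)\Big).$$ **Theorem.** Write $K=\dfrac{m\,m_{\rm neg}\,e^{2c^2\beta}}{BR}$. There is an absolute constant $C$ with the following property. The loss $\mathcal L$ is differentiable, the expectations below exist, and for every $\gamma>0$ and $T\ge1$, $$\mathcal L_{0,T}:=\mathbb E[\mathcal L(\theta_0)-\mathcal L(\theta_T)]\le 4c^2\beta .$$ For every $T\ge1$ there is a threshold $\gamma_T>0$, depending only on $T,m,m_{\rm neg},B,R,c,\beta,L_P,L_H,\sigma$,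 such that for every $0<\gamma\le\gamma_T$ $$\frac1T\sum_{t=0}^{T-1}\mathbb E\|\nabla\mathcal L(\theta_t)\|^2\le\frac{2\mathcal L_{0,T}}{\gamma T}+\frac{24\beta\sigma\,m\,m_{\rm neg}e^{2c^2\beta}}{\gamma BRT}+\gamma\beta^3\sigma^2\,C\Big(L_H K+\frac{L_P2^Rm^2m_{\rm neg}^2e^{6c^2\beta}}{BR^2}\Big).$$ Moreover there is a threshold $\gamma_0>0$, depending only on $m,m_{\rm neg},B,R,c,\beta,L_P,L_H,\sigma$ and not on $T$, such that for every $0<\gamma\le\gamma_0$ and every $T\ge1$ the same inequality holds with $L_HK$ replaced by $L_H\max\{K,\,1+c^2\beta\}$; this is the same inequality whenever $(1+c^2\beta)BR\le m\,m_{\rm neg}e^{2c^2\beta}$, in particular whenever $BR\le m\,m_{\rm neg}$. -/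

import Mathlib

open MeasureTheory

noncomputable section

namespace EMC

/-- Data of a global contrastive learning problem. `X` is the finite support of the marginal
`D_X`, `Y` is the set `D_Y`, the parameter space is `ℝᵖ` and the feature space is `ℝᵈ`.
`neg x` enumerates the `n` (distinct) elements of the negative set `D_neg(x)`. -/
structure Model (X Y : Type*) [MeasurableSpace X] [MeasurableSpace Y] (p d n : ℕ) where
  /-- encoder of the first modality -/
  φ : X → EuclideanSpace ℝ (Fin p) → EuclideanSpace ℝ (Fin d)
  /-- encoder of the second modality -/
  ψ : Y → EuclideanSpace ℝ (Fin p) → EuclideanSpace ℝ (Fin d)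
  /-- distribution of the positive pairs -/
  Dpos : Measure (X × Y)
  /-- enumeration of the negative sets -/
  neg : X → Fin n ↪ Y
  /-- inverse temperature -/
  β : ℝ

variable {X Y : Type*} [MeasurableSpace X] [MeasurableSpace Y] {p d n : ℕ}

namespace Model

/-- The similarity `φ(x;θ)ᵀ ψ(y;θ)`. -/
def sim (M : Model X Y p d n) (x : X) (y : Y) (θ : EuclideanSpace ℝ (Fin p)) : ℝ :=
  inner ℝ (M.φ x θ) (M.ψ y θ)

/-- The sample gradient `H(x,y;θ) = ∇_θ [φ(x;θ)ᵀ ψ(y;θ)]`. -/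
def H (M : Model X Y p d n) (x : X) (y : Y) (θ : EuclideanSpace ℝ (Fin p)) :
    EuclideanSpace ℝ (Fin p) :=
  gradient (M.sim x y) θ

/-- The softmax distribution `p_{x,θ}` on the negative set of `x`. -/
def softmax (M : Model X Y p d n) (x : X) (θ : EuclideanSpace ℝ (Fin p)) (j : Fin n) : ℝ :=
  Real.exp (M.β * M.sim x (M.neg x j) θ) / ∑ i, Real.exp (M.β * M.sim x (M.neg x i) θ)

/-- The global contrastive loss `L(θ)`. -/
def loss (M : Model X Y p d n) (θ : EuclideanSpace ℝ (Fin p)) : ℝ :=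
  ∫ q, -Real.log (Real.exp (M.β * M.sim q.1 q.2 θ) /
    ∑ j, Real.exp (M.β * M.sim q.1 (M.neg q.1 j) θ)) ∂M.Dpos

/-! ### Standing conventions and assumptions -/

/-- `D_pos` is a probability distribution whose marginal on `X` has support all of `X`, and
`y ↦ ψ(y;θ)` is measurable. -/
structure IsDataset (M : Model X Y p d n) : Prop where
  prob : IsProbabilityMeasure M.Dpos
  support : ∀ x : X, M.Dpos (Prod.fst ⁻¹' {x}) ≠ 0
  measurable_ψ : ∀ θ, Measurable fun y => M.ψ y θ

/-- Bounded embeddings. -/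
def BoundedEmbeddings (M : Model X Y p d n) (c : ℝ) : Prop :=
  (∀ x θ, ‖M.φ x θ‖ ≤ c) ∧ ∀ y θ, ‖M.ψ y θ‖ ≤ c

/-- Lipschitz similarity on the pairs `(x,z)`, `z ∈ D_neg(x)`. -/
def LipschitzSimilarity (M : Model X Y p d n) (L_P : ℝ) : Prop :=
  ∀ θ θ' x j, |M.sim x (M.neg x j) θ - M.sim x (M.neg x j) θ'| ≤ L_P * ‖θ - θ'‖

/-- The sample gradients `H(x,y;·)` exist and are Lipschitz. -/
def LipschitzSampleGradient (M : Model X Y p d n) (L_H : ℝ) : Prop :=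
  (∀ x y, Differentiable ℝ (M.sim x y)) ∧
  ∀ θ θ' x y, ‖M.H x y θ - M.H x y θ'‖ ≤ L_H * ‖θ - θ'‖

/-- Bounded gradient noise, for the positive pairs and for the negative pairs. -/
def BoundedGradientNoise (M : Model X Y p d n) (σ : ℝ) : Prop :=
  ∀ θ,
    (∀ᵐ q ∂M.Dpos, ‖M.H q.1 q.2 θ - ∫ q', M.H q'.1 q'.2 θ ∂M.Dpos‖ ≤ σ) ∧
    ∀ x j, ‖M.H x (M.neg x j) θ -
      ∫ q', ∑ i, M.softmax q'.1 θ i • M.H q'.1 (M.neg q'.1 i) θ ∂M.Dpos‖ ≤ σ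

/-! ### The algorithm -/

/-- The Metropolis-Hastings ratio `Q_{x,θ}(Z', Z)`. -/
def ratio (M : Model X Y p d n) (x : X) (θ : EuclideanSpace ℝ (Fin p)) (z' z : Fin n) : ℝ :=
  Real.exp (M.β * M.sim x (M.neg x z') θ) / Real.exp (M.β * M.sim x (M.neg x z) θ)

/-- One Metropolis-Hastings step from the state `z`: `w.1` is the (uniform) proposal, and the
uniform variable `w.2` on `[0,1]` decides on its acceptance. -/
def mhStep (M : Model X Y p d n) (x : X) (θ : EuclideanSpace ℝ (Fin p)) (z : Fin n)
    (w : Fin n × ℝ) : Fin n :=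
  if w.2 ≤ min 1 (M.ratio x θ w.1 z) then w.1 else z

/-- The state after the first `r` of `R` Metropolis-Hastings steps started from `z`. -/
def mhRun (M : Model X Y p d n) {R : ℕ} (x : X) (θ : EuclideanSpace ℝ (Fin p)) (z : Fin n)
    (w : Fin R → Fin n × ℝ) : ℕ → Fin n
  | 0 => z
  | r + 1 => if h : r < R then M.mhStep x θ (M.mhRun x θ z w r) (w ⟨r, h⟩)
      else M.mhRun x θ z w r

/-- The chain states `(Z_x)` after the first `k` elements of the mini-batch are processed. The
`k`-th entry of `w` holds the positive pair `(x,y)` and the randomness of the `R` steps. -/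
def chains [DecidableEq X] (M : Model X Y p d n) {B R : ℕ} (θ : EuclideanSpace ℝ (Fin p))
    (Z : X → Fin n) (w : Fin B → (X × Y) × (Fin R → Fin n × ℝ)) : ℕ → X → Fin n
  | 0 => Z
  | k + 1 => if h : k < B then
        Function.update (M.chains θ Z w k) (w ⟨k, h⟩).1.1
          (M.mhRun (w ⟨k, h⟩).1.1 θ (M.chains θ Z w k (w ⟨k, h⟩).1.1) (w ⟨k, h⟩).2 R)
      else M.chains θ Z w k

/-- The negative sample produced by step `r = 0, …, R-1` for the `k`-th batch element. -/
def sample [DecidableEq X] (M : Model X Y p d n) {B R : ℕ} (θ : EuclideanSpace ℝ (Fin p))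
    (Z : X → Fin n) (w : Fin B → (X × Y) × (Fin R → Fin n × ℝ)) (k : Fin B) (r : ℕ) : Y :=
  M.neg (w k).1.1
    (M.mhRun (w k).1.1 θ (M.chains θ Z w k (w k).1.1) (w k).2 (r + 1))

/-- The stochastic gradient, with burn-in period `P`. -/
def stochGrad [DecidableEq X] (M : Model X Y p d n) {B R : ℕ} (P : ℕ)
    (θ : EuclideanSpace ℝ (Fin p)) (Z : X → Fin n)
    (w : Fin B → (X × Y) × (Fin R → Fin n × ℝ)) : EuclideanSpace ℝ (Fin p) :=
  -((M.β / B) • ∑ k, M.H (w k).1.1 (w k).1.2 θ) +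
    (M.β / (B * ((R : ℝ) - P))) •
      ∑ k, ∑ r ∈ Finset.Ico P R, M.H (w k).1.1 (M.sample θ Z w k r) θ

/-- One iteration, acting on the pair (parameter, chain states). -/
def step [DecidableEq X] (M : Model X Y p d n) {B R : ℕ} (P : ℕ) (γ : ℝ)
    (s : EuclideanSpace ℝ (Fin p) × (X → Fin n))
    (w : Fin B → (X × Y) × (Fin R → Fin n × ℝ)) :
    EuclideanSpace ℝ (Fin p) × (X → Fin n) :=
  (s.1 - γ • M.stochGrad P s.1 s.2 w, M.chains s.1 s.2 w B)

/-- Law of the randomness of one iteration: `B` independent positive pairs from `D_pos`, and for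
each of them `R` independent uniform proposals and uniform variables on `[0,1]`. -/
def noise (M : Model X Y p d n) (B R : ℕ) :
    Measure (Fin B → (X × Y) × (Fin R → Fin n × ℝ)) :=
  Measure.pi fun _ => M.Dpos.prod (Measure.pi fun _ =>
    (ProbabilityTheory.uniformOn (Set.univ : Set (Fin n))).prod
      (volume.restrict (Set.Icc (0 : ℝ) 1)))

/-- Law of `(θ_t, Z_t)`, when `(θ_0, Z_0)` has law `μ₀` and every iteration uses fresh
randomness. -/
def law [DecidableEq X] (M : Model X Y p d n) (B R P : ℕ) (γ : ℝ)
    (μ₀ : Measure (EuclideanSpace ℝ (Fin p) × (X → Fin n))) :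
    ℕ → Measure (EuclideanSpace ℝ (Fin p) × (X → Fin n))
  | 0 => μ₀
  | t + 1 => ((M.law B R P γ μ₀ t).prod (M.noise B R)).map fun a => M.step P γ a.1 a.2

/-- `L_{0,T} = E[L(θ_0) - L(θ_T)]`. -/
def lossGap [DecidableEq X] (M : Model X Y p d n) (B R P : ℕ) (γ : ℝ)
    (μ₀ : Measure (EuclideanSpace ℝ (Fin p) × (X → Fin n))) (T : ℕ) : ℝ :=
  (∫ s, M.loss s.1 ∂(M.law B R P γ μ₀ 0)) - ∫ s, M.loss s.1 ∂(M.law B R P γ μ₀ T)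

/-- `T⁻¹ ∑_{t < T} E ‖∇L(θ_t)‖²`. -/
def avgSqGrad [DecidableEq X] (M : Model X Y p d n) (B R P : ℕ) (γ : ℝ)
    (μ₀ : Measure (EuclideanSpace ℝ (Fin p) × (X → Fin n))) (T : ℕ) : ℝ :=
  (T : ℝ)⁻¹ * ∑ t ∈ Finset.range T, ∫ s, ‖gradient M.loss s.1‖ ^ 2 ∂(M.law B R P γ μ₀ t)

end Model

end EMC

end

/-! Freeze `θ`. For each `x` the Metropolis-Hastings kernel is reversible with respect to the
softmax law, and a proposal is accepted with probability at least its softmax mass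
(`softmax_le_accept`). The kernel therefore dominates `1/n` times its own stationary law: Doeblin's
condition with constant `1/n`, however peaked the softmax is. Removing that part leaves an operator
of norm at most `1 - 1/n` (`norm_residualOp_le`), whose powers agree with those of the kernel on
functions of softmax mean zero. So the Poisson equation for blocks of `R` steps is solved by a
geometric series, and its solution is at most `n/R` times the centered sample gradients
(`norm_chainSol_le`).

The solutions at the current chain states, summed over `x` and scaled by `β/B`, form a correction.
One batch element moves one chain only, and the expected change of the correction cancels the bias
of its negative samples. Over the whole batch, the stochastic gradient plus the new correction has
mean gradient plus old correction (`Regular.integral_stochGrad_add_correction`). Hence the loss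
minus `γ` times the inner product of its gradient with the correction drops in mean by `γ` times the
squared gradient, up to order `γ ^ 2` (`Regular.integral_lyapunov_step_le`).

In the remainder the large Lipschitz constant of the correction always multiplies the gradient norm.
For small `γ`, Young's inequality absorbs it into the squared gradient, so it affects only the step
size thresholds (`remainder_le`). Telescoping over `t` leaves the loss gap, the correction terms at
times `0` and `T`, and a noise term of order `γ`. All smoothness comes from the Lipschitz sample
gradients: a bounded function with Lipschitz gradient has a bounded gradient
(`norm_gradient_sq_le`).

The noise term has a part proportional to `K` and a part proportional to `1 + c ^ 2 * β`. The second
is covered either by the maximum or, when `γ` may depend on `T`, by a spare half of the initial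
mixing term. -/

namespace EMC

/-! ### Functions with Lipschitz gradient -/

section LipschitzGradient

variable {E : Type*} [NormedAddCommGroup E] [InnerProductSpace ℝ E] [CompleteSpace E]

theorem norm_fderiv_eq_norm_gradient (f : E → ℝ) (x : E) : ‖fderiv ℝ f x‖ = ‖gradient f x‖ := by
  simp [gradient]

theorem fderiv_apply_eq_inner_gradient (f : E → ℝ) (x v : E) :
    fderiv ℝ f x v = inner ℝ (gradient f x) v := by
  simp [gradient]

/-- First order Taylor estimate for a function with Lipschitz gradient. -/
theorem abs_taylor_gradient_le {f : E → ℝ} {L : ℝ} (hL : 0 ≤ L) (hf : Differentiable ℝ f)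
    (hlip : ∀ x y, ‖gradient f x - gradient f y‖ ≤ L * ‖x - y‖) (x y : E) :
    |f y - f x - inner ℝ (gradient f x) (y - x)| ≤ L * ‖y - x‖ ^ 2 := by
  -- Mean value inequality for `f` minus its linearization at `x`, on the ball reaching `y`. This
  -- costs the factor `1/2` of the sharp Taylor bound.
  have key := (convex_closedBall x ‖y - x‖).norm_image_sub_le_of_norm_fderiv_le'
    (𝕜 := ℝ) (f := f) (φ := fderiv ℝ f x) (C := L * ‖y - x‖) (x := x) (y := y)
    (fun z _ => hf z) (fun z hz => by
      have : fderiv ℝ f z - fderiv ℝ f x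
          = (InnerProductSpace.toDual ℝ E) (gradient f z - gradient f x) := by
        simp [gradient]
      rw [this, LinearIsometryEquiv.norm_map]
      refine (hlip z x).trans ?_
      gcongr
      simpa [dist_eq_norm] using hz)
    (by simp) (by simp [dist_eq_norm])
  rw [fderiv_apply_eq_inner_gradient, Real.norm_eq_abs] at key
  calc _ ≤ _ := key
    _ = _ := by ring

/-- A bounded function with Lipschitz gradient has a bounded gradient. -/
theorem norm_gradient_sq_le {f : E → ℝ} {L b : ℝ} (hL : 0 ≤ L) (hf : Differentiable ℝ f)
    (hlip : ∀ x y, ‖gradient f x - gradient f y‖ ≤ L * ‖x - y‖) (hb : ∀ x, |f x| ≤ b) (x : E) :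
    ‖gradient f x‖ ^ 2 ≤ 8 * b * L := by
  set g := gradient f x with hg
  have hb0 : 0 ≤ b := (abs_nonneg _).trans (hb x)
  -- A gradient step of size `t` lowers `f` by at least the left side, and `f` oscillates by at most
  -- `2 * b`.
  have main : ∀ t : ℝ, 0 < t → t * ‖g‖ ^ 2 * (1 - t * L) ≤ 2 * b := by
    intro t ht
    have h1 := abs_taylor_gradient_le hL hf hlip x (x - t • g)
    have h2 : (x - t • g) - x = -(t • g) := by abel
    rw [h2, ← hg, inner_neg_right, inner_smul_right, real_inner_self_eq_norm_sq, norm_neg,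
      norm_smul, Real.norm_eq_abs, abs_of_pos ht] at h1
    have h3 := (abs_le.1 (hb x)).2
    have h4 := (abs_le.1 (hb (x - t • g))).1
    have h5 := (abs_le.1 h1).2
    nlinarith
  -- The choice `t = 1 / (2 * L')` needs a positive constant; the case `L = 0` follows by letting
  -- `L'` tend to zero.
  have step : ∀ L' : ℝ, L ≤ L' → 0 < L' → ‖g‖ ^ 2 ≤ 8 * b * L' := by
    intro L' hLL' hL'
    have h := main (1 / (2 * L')) (by positivity)
    have h1 : 1 / (2 * L') * L ≤ 1 / 2 := by
      rw [div_mul_eq_mul_div, div_le_iff₀ (by positivity)]; linarith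
    have h2 : 1 / (2 * L') * ‖g‖ ^ 2 * (1 / 2) ≤ 2 * b :=
      le_trans (by gcongr; linarith) h
    have h3 : 1 / (2 * L') * ‖g‖ ^ 2 * (1 / 2) = ‖g‖ ^ 2 / (4 * L') := by field_simp; ring
    rw [h3, div_le_iff₀ (by positivity)] at h2
    linarith
  rcases hL.eq_or_lt with h0 | h0
  · have : ∀ ε : ℝ, 0 < ε → ‖g‖ ^ 2 ≤ 8 * b * L + ε := by
      intro ε hε
      have h := step (ε / (8 * (b + 1))) (by rw [← h0]; positivity) (by positivity)
      refine h.trans ?_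
      rw [← h0, mul_div_assoc', div_le_iff₀ (by positivity)]
      nlinarith
    exact le_of_forall_pos_le_add this
  · exact step L le_rfl h0

theorem abs_sub_le_of_norm_gradient_le {f : E → ℝ} {G : ℝ} (hf : Differentiable ℝ f)
    (hG : ∀ x, ‖gradient f x‖ ≤ G) (x y : E) : |f x - f y| ≤ G * ‖x - y‖ := by
  have := convex_univ.norm_image_sub_le_of_norm_fderiv_le (𝕜 := ℝ) (f := f) (C := G)
    (fun z _ => hf z) (fun z _ => by rw [norm_fderiv_eq_norm_gradient]; exact hG z)
    (Set.mem_univ y) (Set.mem_univ x)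
  simpa using this

end LipschitzGradient

/-! ### Geometric series and the Poisson operator in a normed ring -/

section Geometric

/-- The average over a final segment of a nonnegative antitone sequence is at most the average. -/
theorem mul_sum_Ico_le_mul_sum_range {u : ℕ → ℝ} (hu : Antitone u) {P R : ℕ} (hPR : P ≤ R) :
    (R : ℝ) * ∑ r ∈ Finset.Ico P R, u r ≤ ((R : ℝ) - P) * ∑ r ∈ Finset.range R, u r := by
  -- The value `u P` separates the terms of the final segment from those before it.
  have h1 : ∑ r ∈ Finset.Ico P R, u r ≤ ((R : ℝ) - P) * u P := by
    have := Finset.sum_le_card_nsmul (Finset.Ico P R) u (u P)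
      (fun r hr => hu (Finset.mem_Ico.1 hr).1)
    simpa [Nat.cast_sub hPR] using this
  have h2 : (P : ℝ) * u P ≤ ∑ r ∈ Finset.range P, u r := by
    have := Finset.card_nsmul_le_sum (Finset.range P) u (u P)
      (fun r hr => hu (Finset.mem_range.1 hr).le)
    simpa using this
  have h3 := Finset.sum_range_add_sum_Ico u hPR
  have h4 : (0 : ℝ) ≤ (R : ℝ) - P := sub_nonneg.2 (by exact_mod_cast hPR)
  have h5 : (0 : ℝ) ≤ P := by positivity
  rw [← h3]
  nlinarith [mul_le_mul_of_nonneg_left h1 h5, mul_le_mul_of_nonneg_left h2 h4]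

variable {A : Type*} [NormedRing A]

/-- Telescoping of the difference of powers. Only `‖1‖ ≤ 1` is assumed because the operators on the
zero space, which occurs for `p = 0`, have `‖1‖ = 0`. -/
theorem norm_pow_sub_pow_le {S S' : A} (h1 : ‖(1 : A)‖ ≤ 1) (hS : ‖S‖ ≤ 1) (hS' : ‖S'‖ ≤ 1)
    (k : ℕ) : ‖S ^ k - S' ^ k‖ ≤ k * ‖S - S'‖ := by
  have hp : ∀ j : ℕ, ‖S ^ j‖ ≤ 1 := by
    intro j
    rcases Nat.eq_zero_or_pos j with rfl | hj
    · simpa using h1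
    · exact (norm_pow_le' S hj).trans (pow_le_one₀ (norm_nonneg _) hS)
  induction k with
  | zero => simp
  | succ k ih =>
    have : S ^ (k + 1) - S' ^ (k + 1) = S ^ k * (S - S') + (S ^ k - S' ^ k) * S' := by
      rw [pow_succ, pow_succ]; noncomm_ring
    rw [this]
    refine (norm_add_le _ _).trans ?_
    have a1 : ‖S ^ k * (S - S')‖ ≤ 1 * ‖S - S'‖ :=
      (norm_mul_le _ _).trans (by gcongr; exact hp k)
    have a2 : ‖(S ^ k - S' ^ k) * S'‖ ≤ (k * ‖S - S'‖) * 1 :=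
      (norm_mul_le _ _).trans (by gcongr)
    push_cast
    linarith

variable {P R : ℕ} {ρ : ℝ} {S S' : A}

theorem norm_pow_le_of_le (hR : 0 < R) (hS : ‖S‖ ≤ ρ) : ‖S ^ R‖ ≤ ρ ^ R :=
  (norm_pow_le' S hR).trans (pow_le_pow_left₀ (norm_nonneg _) hS R)

theorem norm_tsum_pow_le (h1 : ‖(1 : A)‖ ≤ 1) (hR : 0 < R) (hρ : ρ < 1) (hS : ‖S‖ ≤ ρ) :
    ‖∑' j : ℕ, (S ^ R) ^ j‖ ≤ (1 - ρ ^ R)⁻¹ := by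
  have hρ0 : 0 ≤ ρ := (norm_nonneg S).trans hS
  have h2 : ρ ^ R < 1 := pow_lt_one₀ hρ0 hρ hR.ne'
  have h3 := norm_pow_le_of_le hR hS
  refine (tsum_geometric_le_of_norm_lt_one (S ^ R) (h3.trans_lt h2)).trans ?_
  have : (1 - ‖S ^ R‖)⁻¹ ≤ (1 - ρ ^ R)⁻¹ := by
    apply inv_anti₀ <;> linarith
  linarith

variable [NormedAlgebra ℝ A]

/-- The average of `S ^ (r + 1)` over `P ≤ r < R`. -/
noncomputable def powerAverage (P R : ℕ) (S : A) : A :=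
  ((R : ℝ) - P)⁻¹ • ∑ r ∈ Finset.Ico P R, S ^ (r + 1)

/-- The solution operator `(1 - S ^ R)⁻¹ (average of S ^ (r + 1))` of the Poisson equation. -/
noncomputable def poissonOp (P R : ℕ) (S : A) : A :=
  (∑' j : ℕ, (S ^ R) ^ j) * powerAverage P R S

/-- The powers of `ρ` decrease, so burn-in only helps and the bound is free of `P`. One power is
given up to reach the geometric sum that `norm_poissonOp_le` cancels. -/
theorem norm_powerAverage_le (hPR : P < R) (hρ0 : 0 ≤ ρ) (hρ : ρ ≤ 1) (hS : ‖S‖ ≤ ρ) :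
    ‖powerAverage P R S‖ ≤ (R : ℝ)⁻¹ * ∑ r ∈ Finset.range R, ρ ^ r := by
  have hd : (0 : ℝ) < (R : ℝ) - P := sub_pos.2 (by exact_mod_cast hPR)
  have hR : (0 : ℝ) < R := by exact_mod_cast (Nat.zero_le P).trans_lt hPR
  have h1 : ‖∑ r ∈ Finset.Ico P R, S ^ (r + 1)‖ ≤ ∑ r ∈ Finset.Ico P R, ρ ^ r := by
    refine norm_sum_le_of_le _ fun r _ => ?_
    exact (norm_pow_le_of_le (Nat.succ_pos r) hS).trans
      (pow_le_pow_of_le_one hρ0 hρ (Nat.le_succ r))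
  have h2 := mul_sum_Ico_le_mul_sum_range (u := fun r => ρ ^ r)
    (fun a b hab => pow_le_pow_of_le_one hρ0 hρ hab) hPR.le
  rw [powerAverage, norm_smul, norm_inv, Real.norm_eq_abs, abs_of_pos hd]
  rw [inv_mul_le_iff₀ hd, ← mul_assoc, mul_comm ((R : ℝ) - P), mul_assoc, ← div_eq_inv_mul,
    le_div_iff₀ hR, mul_comm]
  exact (mul_le_mul_of_nonneg_left h1 hR.le).trans h2

/-- The numerator `1 - ρ ^ R` of the geometric sum cancels the bound on the inverse of `1 - S ^ R`.
Averaging over a block thus divides the relaxation time by `R`; for `ρ = 1 - 1/n` the result is `n /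
R`. -/
theorem norm_poissonOp_le (h1 : ‖(1 : A)‖ ≤ 1) (hPR : P < R) (hρ : ρ < 1) (hS : ‖S‖ ≤ ρ) :
    ‖poissonOp P R S‖ ≤ (1 - ρ)⁻¹ / R := by
  have hR0 := (Nat.zero_le P).trans_lt hPR
  have hρ0 : 0 ≤ ρ := (norm_nonneg S).trans hS
  have h2 : ρ ^ R < 1 := pow_lt_one₀ hρ0 hρ hR0.ne'
  have h3 : (0 : ℝ) < 1 - ρ ^ R := by linarith
  have h4 : (0 : ℝ) < 1 - ρ := by linarith
  have hR : (0 : ℝ) < R := by exact_mod_cast hR0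
  refine (norm_mul_le _ _).trans ?_
  calc _ ≤ (1 - ρ ^ R)⁻¹ * ((R : ℝ)⁻¹ * ∑ r ∈ Finset.range R, ρ ^ r) := by
        gcongr
        · exact norm_tsum_pow_le h1 hR0 hρ hS
        · exact norm_powerAverage_le hPR hρ0 hρ.le hS
    _ = (1 - ρ)⁻¹ / R := by
        have h5 := geom_sum_mul ρ R
        have : ∑ r ∈ Finset.range R, ρ ^ r = (1 - ρ ^ R) / (1 - ρ) := by
          rw [eq_div_iff h4.ne']; linarith
        rw [this]
        field_simp

variable [CompleteSpace A]

theorem one_sub_mul_poissonOp (hR : 0 < R) (hρ : ρ < 1) (hS : ‖S‖ ≤ ρ) :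
    (1 - S ^ R) * poissonOp P R S = powerAverage P R S := by
  have hρ0 : 0 ≤ ρ := (norm_nonneg S).trans hS
  have : ‖S ^ R‖ < 1 := (norm_pow_le_of_le hR hS).trans_lt (pow_lt_one₀ hρ0 hρ hR.ne')
  rw [poissonOp, ← mul_assoc, mul_neg_geom_series _ this, one_mul]

/-- The resolvent identity handles the inverse and telescoping handles the average. The crude
constant is harmless, as it enters only the step size thresholds. -/
theorem norm_poissonOp_sub_le (h1 : ‖(1 : A)‖ ≤ 1) (hPR : P < R) (hρ : ρ < 1) (hS : ‖S‖ ≤ ρ)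
    (hS' : ‖S'‖ ≤ ρ) :
    ‖poissonOp P R S - poissonOp P R S'‖ ≤ 2 * R * ((1 - ρ)⁻¹) ^ 2 * ‖S - S'‖ := by
  have hR0 := (Nat.zero_le P).trans_lt hPR
  have hρ0 : 0 ≤ ρ := (norm_nonneg S).trans hS
  have h2 : ρ ^ R < 1 := pow_lt_one₀ hρ0 hρ hR0.ne'
  have h4 : (0 : ℝ) < 1 - ρ := by linarith
  have hd : (0 : ℝ) < (R : ℝ) - P := sub_pos.2 (by exact_mod_cast hPR)
  have hR : (1 : ℝ) ≤ R := by exact_mod_cast hR0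
  have hρR : ρ ^ R ≤ ρ := pow_le_of_le_one hρ0 hρ.le hR0.ne'
  set N : A := ∑' j : ℕ, (S ^ R) ^ j with hN
  set N' : A := ∑' j : ℕ, (S' ^ R) ^ j with hN'
  set ν := (1 - ρ)⁻¹ with hν
  have hν1 : 1 ≤ ν := by rw [hν]; exact (one_le_inv₀ h4).2 (by linarith)
  have hNν : ∀ {T : A}, ‖T‖ ≤ ρ → ‖∑' j : ℕ, (T ^ R) ^ j‖ ≤ ν := fun {T} hT =>
    (norm_tsum_pow_le h1 hR0 hρ hT).trans (inv_anti₀ h4 (by linarith))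
  have hlt : ∀ {T : A}, ‖T‖ ≤ ρ → ‖T ^ R‖ < 1 := fun {T} hT =>
    (norm_pow_le_of_le hR0 hT).trans_lt h2
  have e1 : N * (1 - S ^ R) = 1 := geom_series_mul_neg _ (hlt hS)
  have e2 : (1 - S' ^ R) * N' = 1 := mul_neg_geom_series _ (hlt hS')
  have hNN : N - N' = N * (S ^ R - S' ^ R) * N' := by
    calc N - N' = N * ((1 - S' ^ R) * N') - (N * (1 - S ^ R)) * N' := by rw [e1, e2]; simp
      _ = _ := by noncomm_ring
  have hS1 : ‖S‖ ≤ 1 := hS.trans hρ.le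
  have hS1' : ‖S'‖ ≤ 1 := hS'.trans hρ.le
  have hdN : ‖N - N'‖ ≤ ν * (R * ‖S - S'‖) * ν := by
    rw [hNN]
    refine (norm_mul_le _ _).trans ?_
    gcongr
    · refine (norm_mul_le _ _).trans ?_
      gcongr
      · exact hNν hS
      · exact norm_pow_sub_pow_le h1 hS1 hS1' R
    · exact hNν hS'
  have ha : ‖powerAverage P R S'‖ ≤ 1 := by
    refine (norm_powerAverage_le hPR hρ0 hρ.le hS').trans ?_
    rw [inv_mul_le_iff₀ (by linarith), mul_one]
    have := Finset.sum_le_card_nsmul (Finset.range R) (fun r => ρ ^ r) 1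
      (fun r _ => pow_le_one₀ hρ0 hρ.le)
    simpa using this
  have hda : ‖powerAverage P R S - powerAverage P R S'‖ ≤ R * ‖S - S'‖ := by
    rw [powerAverage, powerAverage, ← smul_sub, ← Finset.sum_sub_distrib, norm_smul, norm_inv,
      Real.norm_eq_abs, abs_of_pos hd, inv_mul_le_iff₀ hd]
    have : ‖∑ r ∈ Finset.Ico P R, (S ^ (r + 1) - S' ^ (r + 1))‖
        ≤ ∑ r ∈ Finset.Ico P R, (R : ℝ) * ‖S - S'‖ := by
      refine norm_sum_le_of_le _ fun r hr => ?_
      refine (norm_pow_sub_pow_le h1 hS1 hS1' _).trans ?_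
      gcongr
      exact_mod_cast (Finset.mem_Ico.1 hr).2
    refine this.trans (le_of_eq ?_)
    rw [Finset.sum_const, Nat.card_Ico, nsmul_eq_mul, Nat.cast_sub hPR.le]
  have hsplit : poissonOp P R S - poissonOp P R S'
      = N * (powerAverage P R S - powerAverage P R S') + (N - N') * powerAverage P R S' := by
    rw [poissonOp, poissonOp, ← hN, ← hN']; noncomm_ring
  rw [hsplit]
  refine (norm_add_le _ _).trans ?_
  have b1 : ‖N * (powerAverage P R S - powerAverage P R S')‖ ≤ ν * (R * ‖S - S'‖) :=
    (norm_mul_le _ _).trans (by gcongr; exact hNν hS)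
  have b2 : ‖(N - N') * powerAverage P R S'‖ ≤ (ν * (R * ‖S - S'‖) * ν) * 1 :=
    (norm_mul_le _ _).trans (by gcongr)
  have hX : 0 ≤ R * ‖S - S'‖ := by positivity
  nlinarith [mul_le_mul_of_nonneg_right hν1 (mul_nonneg (zero_le_one.trans hν1) hX)]

end Geometric

end EMC

/-! ### Regularity of the similarities, acceptance probabilities and softmax means -/

namespace EMC

variable {X Y : Type*} [MeasurableSpace X] [MeasurableSpace Y] {p d n : ℕ}

namespace Model

/-- The assumptions on the model which control the regularity of the loss. -/
structure Regular (M : Model X Y p d n) (c L : ℝ) : Prop where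
  data : M.IsDataset
  β_pos : 0 < M.β
  L_nonneg : 0 ≤ L
  bdd : M.BoundedEmbeddings c
  lip : M.LipschitzSampleGradient L

/-- The bound on the sample gradients implied by bounded embeddings and smoothness. -/
noncomputable def gradBound (c L : ℝ) : ℝ := Real.sqrt (8 * c ^ 2 * L)

theorem gradBound_nonneg (c L : ℝ) : 0 ≤ gradBound c L := Real.sqrt_nonneg _

theorem gradBound_sq {c L : ℝ} (hL : 0 ≤ L) : gradBound c L ^ 2 = 8 * c ^ 2 * L :=
  Real.sq_sqrt (by positivity)

/-- The mean of the sample gradients of the negative pairs under the softmax distribution. -/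
noncomputable def meanH (M : Model X Y p d n) (x : X) (θ : EuclideanSpace ℝ (Fin p)) :
    EuclideanSpace ℝ (Fin p) :=
  ∑ i, M.softmax x θ i • M.H x (M.neg x i) θ

/-- The Metropolis-Hastings acceptance probability of a move from `z` to `z'`. -/
noncomputable def accept (M : Model X Y p d n) (x : X) (θ : EuclideanSpace ℝ (Fin p))
    (z z' : Fin n) : ℝ :=
  min 1 (M.ratio x θ z' z)

/-- The constant of Lipschitz continuity of the centered sample gradients. -/
noncomputable def centeredLip (β c L : ℝ) : ℝ := L * (2 + 32 * β * c ^ 2)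

variable {M : Model X Y p d n} {c L : ℝ} {x : X} {y : Y} {θ θ' : EuclideanSpace ℝ (Fin p)}
  {z z' : Fin n}

theorem Regular.abs_sim_le (hM : M.Regular c L) (x : X) (y : Y) (θ : EuclideanSpace ℝ (Fin p)) :
    |M.sim x y θ| ≤ c ^ 2 := by
  have h1 := hM.bdd.1 x θ
  have h2 := hM.bdd.2 y θ
  refine (abs_real_inner_le_norm _ _).trans ?_
  rw [sq]
  exact mul_le_mul h1 h2 (norm_nonneg _) ((norm_nonneg _).trans h1)

theorem Regular.norm_H_le (hM : M.Regular c L) (x : X) (y : Y) (θ : EuclideanSpace ℝ (Fin p)) :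
    ‖M.H x y θ‖ ≤ gradBound c L :=
  Real.le_sqrt_of_sq_le (norm_gradient_sq_le hM.L_nonneg (hM.lip.1 x y)
    (fun a b => hM.lip.2 a b x y) (hM.abs_sim_le x y) θ)

theorem Regular.abs_sim_sub_le (hM : M.Regular c L) (x : X) (y : Y)
    (θ θ' : EuclideanSpace ℝ (Fin p)) :
    |M.sim x y θ - M.sim x y θ'| ≤ gradBound c L * ‖θ - θ'‖ :=
  abs_sub_le_of_norm_gradient_le (hM.lip.1 x y) (hM.norm_H_le x y) θ θ'

theorem Regular.norm_H_sub_le (hM : M.Regular c L) (x : X) (y : Y)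
    (θ θ' : EuclideanSpace ℝ (Fin p)) : ‖M.H x y θ - M.H x y θ'‖ ≤ L * ‖θ - θ'‖ :=
  hM.lip.2 θ θ' x y

section Softmax

/-- Detailed balance: each side is the smaller of the two Boltzmann weights, divided by the
partition function. -/
theorem softmax_mul_accept (M : Model X Y p d n) (x : X) (θ : EuclideanSpace ℝ (Fin p))
    (z z' : Fin n) :
    M.softmax x θ z * M.accept x θ z z' = M.softmax x θ z' * M.accept x θ z' z := by
  have h : ∀ a b : Fin n, M.softmax x θ a * M.accept x θ a b
      = min (Real.exp (M.β * M.sim x (M.neg x a) θ)) (Real.exp (M.β * M.sim x (M.neg x b) θ))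
        / ∑ i, Real.exp (M.β * M.sim x (M.neg x i) θ) := by
    intro a b
    rw [softmax, accept, ratio, div_mul_eq_mul_div, mul_min_of_nonneg _ _ (Real.exp_nonneg _),
      mul_one, mul_div_cancel₀ _ (Real.exp_pos _).ne']
  rw [h, h, min_comm]

theorem accept_le_one (M : Model X Y p d n) (x : X) (θ : EuclideanSpace ℝ (Fin p))
    (z z' : Fin n) : M.accept x θ z z' ≤ 1 := min_le_left _ _

/-- The exponent is nonpositive, and there the exponential is 1-Lipschitz. So the Lipschitz constant
of the acceptance probability carries no exponential factor. -/
theorem accept_eq_exp (M : Model X Y p d n) (x : X) (θ : EuclideanSpace ℝ (Fin p))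
    (z z' : Fin n) :
    M.accept x θ z z'
      = Real.exp (min 0 (M.β * M.sim x (M.neg x z') θ - M.β * M.sim x (M.neg x z) θ)) := by
  rw [accept, ratio, ← Real.exp_sub, ← Real.exp_zero, Real.exp_monotone.map_min]

theorem abs_exp_sub_exp_le_of_nonpos {a b : ℝ} (ha : a ≤ 0) (hb : b ≤ 0) :
    |Real.exp a - Real.exp b| ≤ |a - b| := by
  wlog h : b ≤ a generalizing a b
  · rw [abs_sub_comm, abs_sub_comm a]; exact this hb ha (le_of_not_ge h)
  rw [abs_of_nonneg (sub_nonneg.2 (Real.exp_le_exp.2 h)), abs_of_nonneg (sub_nonneg.2 h)]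
  have h1 := Real.add_one_le_exp (b - a)
  have h2 : Real.exp b = Real.exp a * Real.exp (b - a) := by rw [← Real.exp_add]; ring_nf
  have h3 : Real.exp a ≤ 1 := Real.exp_le_one_iff.2 ha
  have h4 := Real.exp_pos a
  nlinarith

theorem Regular.abs_accept_sub_le (hM : M.Regular c L) (x : X)
    (θ θ' : EuclideanSpace ℝ (Fin p)) (z z' : Fin n) :
    |M.accept x θ z z' - M.accept x θ' z z'| ≤ 2 * M.β * gradBound c L * ‖θ - θ'‖ := by
  rw [accept_eq_exp, accept_eq_exp]
  refine (abs_exp_sub_exp_le_of_nonpos (min_le_left _ _) (min_le_left _ _)).trans ?_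
  refine (abs_min_sub_min_le_max _ _ _ _).trans ?_
  have h1 := abs_le.1 (hM.abs_sim_sub_le x (M.neg x z) θ θ')
  have h2 := abs_le.1 (hM.abs_sim_sub_le x (M.neg x z') θ θ')
  have hβ := hM.β_pos
  have h0 : 0 ≤ 2 * M.β * gradBound c L * ‖θ - θ'‖ := by
    have := gradBound_nonneg c L
    positivity
  rw [sub_self, abs_zero]
  refine max_le h0 (abs_le.2 ⟨?_, ?_⟩)
  · nlinarith
  · nlinarith

variable [NeZero n]

theorem sum_exp_pos (M : Model X Y p d n) (x : X) (θ : EuclideanSpace ℝ (Fin p)) :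
    0 < ∑ i, Real.exp (M.β * M.sim x (M.neg x i) θ) :=
  Finset.sum_pos (fun _ _ => Real.exp_pos _) Finset.univ_nonempty

theorem softmax_nonneg (M : Model X Y p d n) (x : X) (θ : EuclideanSpace ℝ (Fin p)) (i : Fin n) :
    0 ≤ M.softmax x θ i :=
  div_nonneg (Real.exp_nonneg _) (M.sum_exp_pos x θ).le

theorem sum_softmax (M : Model X Y p d n) (x : X) (θ : EuclideanSpace ℝ (Fin p)) :
    ∑ i, M.softmax x θ i = 1 := by
  simp only [softmax]
  rw [← Finset.sum_div, div_self (M.sum_exp_pos x θ).ne']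

/-- The partition function dominates the weight of `z'` and the weight of `z`, which settles the two
branches of the minimum. This is Doeblin's condition for the chain. -/
theorem softmax_le_accept (M : Model X Y p d n) (x : X) (θ : EuclideanSpace ℝ (Fin p))
    (z z' : Fin n) : M.softmax x θ z' ≤ M.accept x θ z z' := by
  have h : ∀ j : Fin n, Real.exp (M.β * M.sim x (M.neg x j) θ)
      ≤ ∑ i, Real.exp (M.β * M.sim x (M.neg x i) θ) := fun j =>
    Finset.single_le_sum (f := fun i => Real.exp (M.β * M.sim x (M.neg x i) θ))
      (fun i _ => Real.exp_nonneg _) (Finset.mem_univ j)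
  refine le_min ((div_le_one (M.sum_exp_pos x θ)).2 (h z')) ?_
  exact div_le_div_of_nonneg_left (Real.exp_nonneg _) (Real.exp_pos _) (h z)

theorem accept_nonneg (M : Model X Y p d n) (x : X) (θ : EuclideanSpace ℝ (Fin p))
    (z z' : Fin n) : 0 ≤ M.accept x θ z z' :=
  (M.softmax_nonneg x θ z').trans (M.softmax_le_accept x θ z z')

/-- Numerator and partition function each change by a factor of at most `exp δ`. The bound is
relative to the softmax mass so that summing over `i` costs no factor `n`. -/
theorem Regular.softmax_sub_le (hM : M.Regular c L) (x : X) (θ θ' : EuclideanSpace ℝ (Fin p))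
    (i : Fin n) :
    M.softmax x θ i - M.softmax x θ' i
      ≤ 2 * M.β * gradBound c L * ‖θ - θ'‖ * M.softmax x θ i := by
  set δ := M.β * (gradBound c L * ‖θ - θ'‖) with hδ
  have hβ := hM.β_pos
  have key : ∀ (θ₁ θ₂ : EuclideanSpace ℝ (Fin p)) (j : Fin n), ‖θ₁ - θ₂‖ = ‖θ - θ'‖ →
      Real.exp (-δ) * Real.exp (M.β * M.sim x (M.neg x j) θ₁)
        ≤ Real.exp (M.β * M.sim x (M.neg x j) θ₂) := by
    intro θ₁ θ₂ j h
    rw [← Real.exp_add]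
    refine Real.exp_le_exp.2 ?_
    have h1 := abs_le.1 (hM.abs_sim_sub_le x (M.neg x j) θ₁ θ₂)
    rw [h] at h1
    nlinarith [mul_le_mul_of_nonneg_left h1.2 hβ.le]
  have hnum := key θ θ' i rfl
  have hden : Real.exp (-δ) * ∑ j, Real.exp (M.β * M.sim x (M.neg x j) θ')
      ≤ ∑ j, Real.exp (M.β * M.sim x (M.neg x j) θ) := by
    rw [Finset.mul_sum]
    exact Finset.sum_le_sum fun j _ => key θ' θ j (norm_sub_rev _ _)
  have hS := M.sum_exp_pos x θ
  have hS' := M.sum_exp_pos x θ'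
  have h2 : (1 - 2 * δ) * M.softmax x θ i ≤ M.softmax x θ' i := by
    have h3 : Real.exp (-δ) * Real.exp (-δ) * M.softmax x θ i ≤ M.softmax x θ' i := by
      rw [softmax, softmax, mul_div_assoc', div_le_div_iff₀ hS hS']
      calc _ = (Real.exp (-δ) * Real.exp (M.β * M.sim x (M.neg x i) θ)) *
            (Real.exp (-δ) * ∑ j, Real.exp (M.β * M.sim x (M.neg x j) θ')) := by ring
        _ ≤ _ := mul_le_mul hnum hden (by positivity) (Real.exp_nonneg _)
    refine le_trans (mul_le_mul_of_nonneg_right ?_ (M.softmax_nonneg x θ i)) h3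
    rw [← Real.exp_add]
    have := Real.add_one_le_exp (-δ + -δ)
    linarith
  have : 2 * M.β * gradBound c L * ‖θ - θ'‖ = 2 * δ := by rw [hδ]; ring
  rw [this]
  linarith

theorem Regular.sum_abs_softmax_sub_le (hM : M.Regular c L) (x : X)
    (θ θ' : EuclideanSpace ℝ (Fin p)) :
    ∑ i, |M.softmax x θ i - M.softmax x θ' i| ≤ 4 * M.β * gradBound c L * ‖θ - θ'‖ := by
  set δ := 2 * M.β * gradBound c L * ‖θ - θ'‖ with hδ
  have hδ0 : 0 ≤ δ := by
    have := gradBound_nonneg c L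
    have := hM.β_pos
    positivity
  have h : ∀ i, |M.softmax x θ i - M.softmax x θ' i|
      ≤ δ * (M.softmax x θ i + M.softmax x θ' i) := by
    intro i
    have h1 := hM.softmax_sub_le x θ θ' i
    have h2 := hM.softmax_sub_le x θ' θ i
    rw [norm_sub_rev θ' θ] at h2
    have h3 := mul_nonneg hδ0 (M.softmax_nonneg x θ i)
    have h4 := mul_nonneg hδ0 (M.softmax_nonneg x θ' i)
    exact abs_le.2 ⟨by linarith, by linarith⟩
  refine (Finset.sum_le_sum fun i _ => h i).trans ?_
  rw [← Finset.mul_sum, Finset.sum_add_distrib, sum_softmax, sum_softmax]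
  linarith

theorem norm_sum_softmax_smul_le (M : Model X Y p d n) (x : X) (θ : EuclideanSpace ℝ (Fin p))
    {f : Fin n → EuclideanSpace ℝ (Fin p)} {b : ℝ} (hf : ∀ i, ‖f i‖ ≤ b) :
    ‖∑ i, M.softmax x θ i • f i‖ ≤ b := by
  calc _ ≤ ∑ i, M.softmax x θ i * b := by
        refine norm_sum_le_of_le _ fun i _ => ?_
        rw [norm_smul, Real.norm_eq_abs, abs_of_nonneg (M.softmax_nonneg x θ i)]
        exact mul_le_mul_of_nonneg_left (hf i) (M.softmax_nonneg x θ i)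
    _ = b := by rw [← Finset.sum_mul, sum_softmax, one_mul]

theorem Regular.norm_sum_softmax_smul_sub_le (hM : M.Regular c L) (x : X)
    (θ θ' : EuclideanSpace ℝ (Fin p)) {f : Fin n → EuclideanSpace ℝ (Fin p)} {b : ℝ}
    (hf : ∀ i, ‖f i‖ ≤ b) (hb : 0 ≤ b) :
    ‖∑ i, M.softmax x θ i • f i - ∑ i, M.softmax x θ' i • f i‖
      ≤ 4 * M.β * gradBound c L * ‖θ - θ'‖ * b := by
  rw [← Finset.sum_sub_distrib]
  calc _ ≤ ∑ i, |M.softmax x θ i - M.softmax x θ' i| * b := by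
        refine norm_sum_le_of_le _ fun i _ => ?_
        rw [← sub_smul, norm_smul, Real.norm_eq_abs]
        exact mul_le_mul_of_nonneg_left (hf i) (abs_nonneg _)
    _ ≤ _ := by
        rw [← Finset.sum_mul]
        exact mul_le_mul_of_nonneg_right (hM.sum_abs_softmax_sub_le x θ θ') hb

theorem Regular.norm_meanH_le (hM : M.Regular c L) (x : X) (θ : EuclideanSpace ℝ (Fin p)) :
    ‖M.meanH x θ‖ ≤ gradBound c L :=
  M.norm_sum_softmax_smul_le x θ fun i => hM.norm_H_le x (M.neg x i) θ

theorem Regular.norm_meanH_sub_le (hM : M.Regular c L) (x : X)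
    (θ θ' : EuclideanSpace ℝ (Fin p)) :
    ‖M.meanH x θ - M.meanH x θ'‖ ≤ L * (1 + 32 * M.β * c ^ 2) * ‖θ - θ'‖ := by
  have h1 := hM.norm_sum_softmax_smul_sub_le x θ θ'
    (f := fun i => M.H x (M.neg x i) θ) (fun i => hM.norm_H_le x _ θ) (gradBound_nonneg c L)
  have h2 : ‖∑ i, M.softmax x θ' i • (M.H x (M.neg x i) θ - M.H x (M.neg x i) θ')‖
      ≤ L * ‖θ - θ'‖ :=
    M.norm_sum_softmax_smul_le x θ' fun i => hM.norm_H_sub_le x (M.neg x i) θ θ'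
  have h3 : M.meanH x θ - M.meanH x θ'
      = (∑ i, M.softmax x θ i • M.H x (M.neg x i) θ - ∑ i, M.softmax x θ' i • M.H x (M.neg x i) θ)
        + ∑ i, M.softmax x θ' i • (M.H x (M.neg x i) θ - M.H x (M.neg x i) θ') := by
    simp only [smul_sub, Finset.sum_sub_distrib, meanH]
    abel
  rw [h3]
  refine (norm_add_le _ _).trans ((add_le_add h1 h2).trans (le_of_eq ?_))
  have := gradBound_sq (c := c) hM.L_nonneg
  calc _ = 4 * M.β * gradBound c L ^ 2 * ‖θ - θ'‖ + L * ‖θ - θ'‖ := by ring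
    _ = _ := by rw [this]; ring

/-- The centered sample gradients of the negative pairs of `x`. -/
noncomputable def centeredH (M : Model X Y p d n) (x : X) (θ : EuclideanSpace ℝ (Fin p)) :
    Fin n → EuclideanSpace ℝ (Fin p) :=
  fun z => M.H x (M.neg x z) θ - M.meanH x θ

theorem Regular.norm_centeredH_le (hM : M.Regular c L) (x : X) (θ : EuclideanSpace ℝ (Fin p)) :
    ‖M.centeredH x θ‖ ≤ 2 * gradBound c L := by
  refine (pi_norm_le_iff_of_nonneg (by have := gradBound_nonneg c L; positivity)).2 fun z => ?_
  refine (norm_sub_le _ _).trans ?_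
  have h1 := hM.norm_H_le x (M.neg x z) θ
  have h2 := hM.norm_meanH_le x θ
  linarith

/-- The noise assumption centers at a mean over all `x`, and the softmax mean of a single `x` is
itself within `σ` of it. This bound brings `σ` into the rate; `Regular.norm_centeredH_le` serves
Lipschitz and integrability estimates. -/
theorem norm_centeredH_le_of_noise {σ : ℝ} (hσ : 0 ≤ σ) {a : EuclideanSpace ℝ (Fin p)}
    (h : ∀ j, ‖M.H x (M.neg x j) θ - a‖ ≤ σ) : ‖M.centeredH x θ‖ ≤ 2 * σ := by
  refine (pi_norm_le_iff_of_nonneg (by positivity)).2 fun z => ?_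
  have h1 := M.norm_sum_softmax_smul_le x θ h
  have h2 : M.centeredH x θ z
      = (M.H x (M.neg x z) θ - a) - ∑ i, M.softmax x θ i • (M.H x (M.neg x i) θ - a) := by
    simp only [smul_sub, Finset.sum_sub_distrib, ← Finset.sum_smul, sum_softmax, one_smul,
      centeredH, meanH]
    abel
  rw [h2]
  refine (norm_sub_le _ _).trans ?_
  linarith [h z]

theorem Regular.norm_centeredH_sub_le (hM : M.Regular c L) (x : X)
    (θ θ' : EuclideanSpace ℝ (Fin p)) :
    ‖M.centeredH x θ - M.centeredH x θ'‖ ≤ centeredLip M.β c L * ‖θ - θ'‖ := by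
  have h0 : 0 ≤ centeredLip M.β c L := by
    have := hM.L_nonneg
    have := hM.β_pos
    unfold centeredLip
    positivity
  refine (pi_norm_le_iff_of_nonneg (by positivity)).2 fun z => ?_
  have h1 := hM.norm_H_sub_le x (M.neg x z) θ θ'
  have h2 := hM.norm_meanH_sub_le x θ θ'
  have h3 : (M.centeredH x θ - M.centeredH x θ') z
      = (M.H x (M.neg x z) θ - M.H x (M.neg x z) θ') - (M.meanH x θ - M.meanH x θ') := by
    simp only [Pi.sub_apply, centeredH]
    abel
  rw [h3]
  refine (norm_sub_le _ _).trans ((add_le_add h1 h2).trans (le_of_eq ?_))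
  rw [centeredLip]
  ring

end Softmax

/-! ### The Metropolis-Hastings kernel and its Poisson equation -/

section Operator

/-- The transition operator of the Metropolis-Hastings chain. -/
noncomputable def mhOp (M : Model X Y p d n) (x : X) (θ : EuclideanSpace ℝ (Fin p)) :
    (Fin n → EuclideanSpace ℝ (Fin p)) →L[ℝ] (Fin n → EuclideanSpace ℝ (Fin p)) :=
  ContinuousLinearMap.pi fun z => (n : ℝ)⁻¹ • ∑ z', (M.accept x θ z z' •
    ContinuousLinearMap.proj (R := ℝ) (φ := fun _ : Fin n => EuclideanSpace ℝ (Fin p)) z' +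
    (1 - M.accept x θ z z') • ContinuousLinearMap.proj z)

/-- Integration against the softmax distribution. -/
noncomputable def meanOp (M : Model X Y p d n) (x : X) (θ : EuclideanSpace ℝ (Fin p)) :
    (Fin n → EuclideanSpace ℝ (Fin p)) →L[ℝ] (Fin n → EuclideanSpace ℝ (Fin p)) :=
  ContinuousLinearMap.pi fun _ => ∑ i, M.softmax x θ i •
    ContinuousLinearMap.proj (R := ℝ) (φ := fun _ : Fin n => EuclideanSpace ℝ (Fin p)) i

/-- The transition operator with the part provided by Doeblin's condition removed. -/
noncomputable def residualOp (M : Model X Y p d n) (x : X) (θ : EuclideanSpace ℝ (Fin p)) :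
    (Fin n → EuclideanSpace ℝ (Fin p)) →L[ℝ] (Fin n → EuclideanSpace ℝ (Fin p)) :=
  M.mhOp x θ - (n : ℝ)⁻¹ • M.meanOp x θ

variable (f : Fin n → EuclideanSpace ℝ (Fin p))

theorem mhOp_apply (M : Model X Y p d n) (x : X) (θ : EuclideanSpace ℝ (Fin p)) (z : Fin n) :
    M.mhOp x θ f z = (n : ℝ)⁻¹ • ∑ z', (M.accept x θ z z' • f z' +
      (1 - M.accept x θ z z') • f z) := by
  simp [mhOp]

theorem meanOp_apply (M : Model X Y p d n) (x : X) (θ : EuclideanSpace ℝ (Fin p)) (z : Fin n) :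
    M.meanOp x θ f z = ∑ i, M.softmax x θ i • f i := by
  simp [meanOp]

theorem residualOp_apply (M : Model X Y p d n) (x : X) (θ : EuclideanSpace ℝ (Fin p))
    (z : Fin n) :
    M.residualOp x θ f z = (n : ℝ)⁻¹ • ∑ z', ((M.accept x θ z z' - M.softmax x θ z') • f z' +
      (1 - M.accept x θ z z') • f z) := by
  simp only [residualOp, sub_apply, smul_apply,
    Pi.sub_apply, Pi.smul_apply, mhOp_apply, meanOp_apply]
  rw [← smul_sub, ← Finset.sum_sub_distrib]
  congr 1
  refine Finset.sum_congr rfl fun z' _ => ?_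
  rw [sub_smul (M.accept x θ z z')]
  abel

variable [NeZero n]

theorem natCast_pos_of_neZero : (0 : ℝ) < n := by exact_mod_cast Nat.pos_of_ne_zero (NeZero.ne n)

/-- By `softmax_le_accept` the coefficients stay nonnegative after the subtraction, and their total
mass drops from `1` to `1 - 1/n`. -/
theorem norm_residualOp_le (M : Model X Y p d n) (x : X) (θ : EuclideanSpace ℝ (Fin p)) :
    ‖M.residualOp x θ‖ ≤ 1 - (n : ℝ)⁻¹ := by
  have hn : (0 : ℝ) < n := natCast_pos_of_neZero
  have h1 : (0 : ℝ) ≤ 1 - (n : ℝ)⁻¹ := by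
    have : (1 : ℝ) ≤ n := by exact_mod_cast Nat.pos_of_ne_zero (NeZero.ne n)
    have := inv_le_one_of_one_le₀ this
    linarith
  refine ContinuousLinearMap.opNorm_le_bound _ h1 fun f => ?_
  refine (pi_norm_le_iff_of_nonneg (by positivity)).2 fun z => ?_
  rw [residualOp_apply, norm_smul, norm_inv, Real.norm_eq_abs, abs_of_pos hn,
    inv_mul_le_iff₀ hn]
  calc _ ≤ ∑ z', (1 - M.softmax x θ z') * ‖f‖ := by
        refine norm_sum_le_of_le _ fun z' _ => (norm_add_le _ _).trans ?_
        have ha := sub_nonneg.2 (M.softmax_le_accept x θ z z')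
        have hb := sub_nonneg.2 (M.accept_le_one x θ z z')
        rw [norm_smul, norm_smul, Real.norm_eq_abs, Real.norm_eq_abs, abs_of_nonneg ha,
          abs_of_nonneg hb]
        have h2 := mul_le_mul_of_nonneg_left (norm_le_pi_norm f z') ha
        have h3 := mul_le_mul_of_nonneg_left (norm_le_pi_norm f z) hb
        linarith
    _ = _ := by
        rw [← Finset.sum_mul, Finset.sum_sub_distrib, sum_softmax]
        simp only [Finset.sum_const, Finset.card_univ, Fintype.card_fin, nsmul_eq_mul, mul_one]
        field_simp

theorem Regular.norm_residualOp_sub_le (hM : M.Regular c L) (x : X)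
    (θ θ' : EuclideanSpace ℝ (Fin p)) :
    ‖M.residualOp x θ - M.residualOp x θ'‖ ≤ 8 * M.β * gradBound c L * ‖θ - θ'‖ := by
  have hn : (0 : ℝ) < n := natCast_pos_of_neZero
  set δ := M.β * gradBound c L * ‖θ - θ'‖ with hδ
  have hδ0 : 0 ≤ δ := by
    have := gradBound_nonneg c L
    have := hM.β_pos
    positivity
  have e : 8 * M.β * gradBound c L * ‖θ - θ'‖ = 8 * δ := by rw [hδ]; ring
  rw [e]
  refine ContinuousLinearMap.opNorm_le_bound _ (by positivity) fun f => ?_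
  refine (pi_norm_le_iff_of_nonneg (by positivity)).2 fun z => ?_
  rw [sub_apply, Pi.sub_apply, residualOp_apply, residualOp_apply, ← smul_sub,
    ← Finset.sum_sub_distrib, norm_smul, norm_inv, Real.norm_eq_abs, abs_of_pos hn,
    inv_mul_le_iff₀ hn]
  calc _ ≤ ∑ z', (4 * δ + |M.softmax x θ z' - M.softmax x θ' z'|) * ‖f‖ := by
        refine norm_sum_le_of_le _ fun z' _ => ?_
        have ha := hM.abs_accept_sub_le x θ θ' z z'
        rw [show 2 * M.β * gradBound c L * ‖θ - θ'‖ = 2 * δ by rw [hδ]; ring] at ha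
        have e1 : (M.accept x θ z z' - M.softmax x θ z') • f z' + (1 - M.accept x θ z z') • f z
            - ((M.accept x θ' z z' - M.softmax x θ' z') • f z' + (1 - M.accept x θ' z z') • f z)
            = (M.accept x θ z z' - M.accept x θ' z z') • f z'
              - (M.accept x θ z z' - M.accept x θ' z z') • f z
              - (M.softmax x θ z' - M.softmax x θ' z') • f z' := by
          module
        rw [e1]
        refine (norm_sub_le _ _).trans ((add_le_add_left (norm_sub_le _ _) _).trans ?_)
        rw [norm_smul, norm_smul, norm_smul, Real.norm_eq_abs, Real.norm_eq_abs]
        have h1 := mul_le_mul ha (norm_le_pi_norm f z') (norm_nonneg _) (by positivity)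
        have h2 := mul_le_mul ha (norm_le_pi_norm f z) (norm_nonneg _) (by positivity)
        have h3 := mul_le_mul_of_nonneg_left (norm_le_pi_norm f z')
          (abs_nonneg (M.softmax x θ z' - M.softmax x θ' z'))
        linarith
    _ = (4 * δ * n + ∑ z', |M.softmax x θ z' - M.softmax x θ' z'|) * ‖f‖ := by
        rw [← Finset.sum_mul, Finset.sum_add_distrib]
        simp only [Finset.sum_const, Finset.card_univ, Fintype.card_fin, nsmul_eq_mul]
        ring
    _ ≤ (4 * δ * n + 4 * δ * n) * ‖f‖ := by
        gcongr
        refine (hM.sum_abs_softmax_sub_le x θ θ').trans ?_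
        have : (1 : ℝ) ≤ n := by exact_mod_cast Nat.pos_of_ne_zero (NeZero.ne n)
        rw [show 4 * M.β * gradBound c L * ‖θ - θ'‖ = 4 * δ by rw [hδ]; ring]
        nlinarith
    _ = _ := by ring

/-- The softmax distribution is stationary for the Metropolis-Hastings chain. -/
theorem sum_softmax_smul_mhOp (M : Model X Y p d n) (x : X) (θ : EuclideanSpace ℝ (Fin p)) :
    ∑ z, M.softmax x θ z • M.mhOp x θ f z = ∑ z, M.softmax x θ z • f z := by
  have hn : (n : ℝ) ≠ 0 := natCast_pos_of_neZero.ne'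
  have h1 : ∀ z, M.softmax x θ z • ∑ z', (M.accept x θ z z' • f z' +
      (1 - M.accept x θ z z') • f z) = ∑ z', (M.softmax x θ z * M.accept x θ z z') • f z'
        - ∑ z', (M.softmax x θ z * M.accept x θ z z') • f z + (n : ℝ) • M.softmax x θ z • f z := by
    intro z
    have : (n : ℝ) • M.softmax x θ z • f z = ∑ _z' : Fin n, M.softmax x θ z • f z := by
      simp [← Nat.cast_smul_eq_nsmul ℝ]
    rw [this, Finset.smul_sum, ← Finset.sum_sub_distrib, ← Finset.sum_add_distrib]
    refine Finset.sum_congr rfl fun z' _ => ?_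
    module
  -- Detailed balance after exchanging the sums: the mass leaving each state equals the mass
  -- entering it.
  have h2 : ∑ z, ∑ z', (M.softmax x θ z * M.accept x θ z z') • f z
      = ∑ z, ∑ z', (M.softmax x θ z * M.accept x θ z z') • f z' := by
    rw [Finset.sum_comm]
    refine Finset.sum_congr rfl fun z _ => Finset.sum_congr rfl fun z' _ => ?_
    rw [softmax_mul_accept]
  simp only [mhOp_apply, smul_comm _ ((n : ℝ)⁻¹), h1]
  rw [← Finset.smul_sum, inv_smul_eq_iff₀ hn, Finset.sum_add_distrib, Finset.sum_sub_distrib, h2,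
    sub_self, zero_add, Finset.smul_sum]

/-- Stationarity carries the mean through the kernel, and the removed part takes away `1/n` of it at
each application. -/
theorem meanOp_residualOp_pow (M : Model X Y p d n) (x : X) (θ : EuclideanSpace ℝ (Fin p))
    (k : ℕ) : M.meanOp x θ ((M.residualOp x θ ^ k) f) = (1 - (n : ℝ)⁻¹) ^ k • M.meanOp x θ f := by
  induction k with
  | zero => simp
  | succ k ih =>
    have h : ∀ g, M.meanOp x θ (M.residualOp x θ g) = (1 - (n : ℝ)⁻¹) • M.meanOp x θ g := by
      intro g
      rw [residualOp, sub_apply, smul_apply, map_sub, map_smul, sub_smul, one_smul]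
      congr 1
      · funext z
        rw [meanOp_apply, meanOp_apply, sum_softmax_smul_mhOp]
      · congr 1
        funext z
        rw [meanOp_apply]
        simp only [meanOp_apply]
        rw [← Finset.sum_smul, sum_softmax, one_smul]
    rw [pow_succ', mul_apply_eq_comp, h, ih, pow_succ', mul_smul]

/-- The removed part sees only the softmax mean, which stays zero along the powers. So the
contraction of the residual operator applies to the chain itself. -/
theorem mhOp_pow_eq_residualOp_pow (M : Model X Y p d n) (x : X)
    (θ : EuclideanSpace ℝ (Fin p)) {f : Fin n → EuclideanSpace ℝ (Fin p)}
    (hf : M.meanOp x θ f = 0) (k : ℕ) : (M.mhOp x θ ^ k) f = (M.residualOp x θ ^ k) f := by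
  induction k with
  | zero => rfl
  | succ k ih =>
    rw [pow_succ', pow_succ', mul_apply_eq_comp, mul_apply_eq_comp, ih]
    have h := M.meanOp_residualOp_pow f x θ k
    rw [hf, smul_zero] at h
    nth_rewrite 2 [residualOp]
    rw [sub_apply, smul_apply, h, smul_zero, sub_zero]

theorem meanOp_centeredH (M : Model X Y p d n) (x : X) (θ : EuclideanSpace ℝ (Fin p)) :
    M.meanOp x θ (M.centeredH x θ) = 0 := by
  funext z
  rw [meanOp_apply]
  simp only [centeredH, smul_sub, Finset.sum_sub_distrib, ← Finset.sum_smul, sum_softmax, one_smul]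
  exact sub_self _

/-- The solution of the Poisson equation of the chain of `x`. -/
noncomputable def chainSol (M : Model X Y p d n) (P R : ℕ) (x : X)
    (θ : EuclideanSpace ℝ (Fin p)) : Fin n → EuclideanSpace ℝ (Fin p) :=
  poissonOp P R (M.residualOp x θ) (M.centeredH x θ)

variable {P R : ℕ}

theorem one_sub_inv_lt_one : 1 - (n : ℝ)⁻¹ < 1 := by
  have hn : (0 : ℝ) < n := natCast_pos_of_neZero
  have := inv_pos.2 hn
  linarith

/-- Taking means in the Poisson equation multiplies the mean of the solution by `1 - (1 - 1/n) ^ R`,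
which is nonzero, while the right side has mean zero. -/
theorem meanOp_chainSol (M : Model X Y p d n) (hPR : P < R) (x : X)
    (θ : EuclideanSpace ℝ (Fin p)) : M.meanOp x θ (M.chainSol P R x θ) = 0 := by
  have hR := (Nat.zero_le P).trans_lt hPR
  have h1 := congrArg (fun A => M.meanOp x θ (A (M.centeredH x θ)))
    (one_sub_mul_poissonOp (P := P) hR one_sub_inv_lt_one (M.norm_residualOp_le x θ))
  simp only [powerAverage, mul_apply_eq_comp, sub_apply,
    smul_apply, one_apply_eq_self, map_sub, map_smul,
    sum_apply, map_sum, meanOp_residualOp_pow, meanOp_centeredH, smul_zero,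
    Finset.sum_const_zero] at h1
  rw [← chainSol, ← one_smul ℝ (M.meanOp x θ (M.chainSol P R x θ)), smul_smul, mul_one,
    ← sub_smul, smul_eq_zero] at h1
  refine h1.resolve_left ?_
  have : (1 - (n : ℝ)⁻¹) ^ R < 1 :=
    pow_lt_one₀ ((norm_nonneg _).trans (M.norm_residualOp_le x θ)) one_sub_inv_lt_one hR.ne'
  linarith

/-- The equation was solved for the residual operator. As the solution and the centered gradients
both have mean zero, the true kernel may take its place. -/
theorem chainSol_sub_mhOp_pow (M : Model X Y p d n) (hPR : P < R) (x : X)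
    (θ : EuclideanSpace ℝ (Fin p)) :
    M.chainSol P R x θ - (M.mhOp x θ ^ R) (M.chainSol P R x θ)
      = ((R : ℝ) - P)⁻¹ • ∑ r ∈ Finset.Ico P R, (M.mhOp x θ ^ (r + 1)) (M.centeredH x θ) := by
  have hR := (Nat.zero_le P).trans_lt hPR
  have h1 := congrArg (fun A => A (M.centeredH x θ))
    (one_sub_mul_poissonOp (P := P) hR one_sub_inv_lt_one (M.norm_residualOp_le x θ))
  simp only [powerAverage, mul_apply_eq_comp, sub_apply,
    smul_apply, one_apply_eq_self,
    sum_apply] at h1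
  change M.chainSol P R x θ - (M.residualOp x θ ^ R) (M.chainSol P R x θ) = _ at h1
  rw [mhOp_pow_eq_residualOp_pow M x θ (M.meanOp_chainSol hPR x θ), h1]
  simp only [mhOp_pow_eq_residualOp_pow M x θ (M.meanOp_centeredH x θ)]

theorem norm_chainSol_le (M : Model X Y p d n) (hPR : P < R) (x : X)
    (θ : EuclideanSpace ℝ (Fin p)) :
    ‖M.chainSol P R x θ‖ ≤ n / R * ‖M.centeredH x θ‖ := by
  refine (ContinuousLinearMap.le_opNorm _ _).trans ?_
  gcongr
  refine (norm_poissonOp_le ContinuousLinearMap.norm_id_le hPR one_sub_inv_lt_one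
    (M.norm_residualOp_le x θ)).trans (le_of_eq ?_)
  simp

/-- Up to the factor `L`, the Lipschitz constant of the solutions of the Poisson equations. -/
noncomputable def solLip (n R : ℕ) (β c : ℝ) : ℝ := n ^ 2 * R * (2 + 288 * β * c ^ 2)

theorem Regular.norm_chainSol_sub_le (hM : M.Regular c L) (hPR : P < R) (x : X)
    (θ θ' : EuclideanSpace ℝ (Fin p)) :
    ‖M.chainSol P R x θ - M.chainSol P R x θ'‖ ≤ solLip n R M.β c * L * ‖θ - θ'‖ := by
  have hn : (1 : ℝ) ≤ n := by exact_mod_cast Nat.pos_of_ne_zero (NeZero.ne n)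
  have hR : (1 : ℝ) ≤ R := by exact_mod_cast (Nat.zero_le P).trans_lt hPR
  have hβ := hM.β_pos
  have hL := hM.L_nonneg
  have hg := gradBound_nonneg c L
  set T := poissonOp P R (M.residualOp x θ) with hT
  set T' := poissonOp P R (M.residualOp x θ') with hT'
  have e : M.chainSol P R x θ - M.chainSol P R x θ'
      = T (M.centeredH x θ - M.centeredH x θ') + (T - T') (M.centeredH x θ') := by
    simp only [chainSol, map_sub, sub_apply, ← hT, ← hT']
    abel
  have h1 : ‖T‖ ≤ n := by
    refine (norm_poissonOp_le ContinuousLinearMap.norm_id_le hPR one_sub_inv_lt_one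
      (M.norm_residualOp_le x θ)).trans ?_
    rw [sub_sub_cancel, inv_inv]
    exact div_le_self (by linarith) hR
  have h2 : ‖T - T'‖ ≤ 2 * R * (n : ℝ) ^ 2 * (8 * M.β * gradBound c L * ‖θ - θ'‖) := by
    refine (norm_poissonOp_sub_le ContinuousLinearMap.norm_id_le hPR one_sub_inv_lt_one
      (M.norm_residualOp_le x θ) (M.norm_residualOp_le x θ')).trans ?_
    rw [sub_sub_cancel, inv_inv]
    gcongr
    exact hM.norm_residualOp_sub_le x θ θ'
  rw [e]
  refine (norm_add_le _ _).trans ?_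
  have h3 : ‖T (M.centeredH x θ - M.centeredH x θ')‖ ≤ n * (centeredLip M.β c L * ‖θ - θ'‖) :=
    (ContinuousLinearMap.le_opNorm _ _).trans
      (mul_le_mul h1 (hM.norm_centeredH_sub_le x θ θ') (norm_nonneg _) (by positivity))
  have h4 : ‖(T - T') (M.centeredH x θ')‖
      ≤ 2 * R * (n : ℝ) ^ 2 * (8 * M.β * gradBound c L * ‖θ - θ'‖) * (2 * gradBound c L) :=
    (ContinuousLinearMap.le_opNorm _ _).trans
      (mul_le_mul h2 (hM.norm_centeredH_le x θ') (norm_nonneg _) (by positivity))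
  have h5 : (n : ℝ) * (centeredLip M.β c L * ‖θ - θ'‖)
      ≤ (n ^ 2 * R) * (centeredLip M.β c L * ‖θ - θ'‖) := by
    have : 0 ≤ centeredLip M.β c L * ‖θ - θ'‖ := by unfold centeredLip; positivity
    refine mul_le_mul_of_nonneg_right ?_ this
    nlinarith
  refine (add_le_add (h3.trans h5) h4).trans (le_of_eq ?_)
  -- The gradient bound occurs squared, once from the kernel and once from the centered gradients.
  -- This makes the constant linear in `L`, on which `step_conditions` relies.
  have hsq := gradBound_sq (c := c) hL
  calc _ = n ^ 2 * R * (centeredLip M.β c L * ‖θ - θ'‖)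
        + 32 * R * n ^ 2 * M.β * ‖θ - θ'‖ * gradBound c L ^ 2 := by ring
    _ = _ := by rw [hsq, centeredLip, solLip]; ring

end Operator

end Model

end EMC

/-! ### Continuity and measurability of the algorithm -/

namespace EMC

theorem continuous_of_norm_sub_le {E F : Type*} [SeminormedAddCommGroup E]
    [SeminormedAddCommGroup F] {f : E → F} {K : ℝ} (h : ∀ x y, ‖f x - f y‖ ≤ K * ‖x - y‖) :
    Continuous f :=
  (LipschitzWith.of_dist_le' (K := K) fun x y => by
    simpa only [dist_eq_norm] using h x y).continuous

namespace Model

variable {X Y : Type*} [MeasurableSpace X] [MeasurableSpace Y] {p d n : ℕ}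
  {M : Model X Y p d n} {c L : ℝ}

section Continuity

theorem Regular.continuous_sim (hM : M.Regular c L) (x : X) (y : Y) :
    Continuous (M.sim x y) := (hM.lip.1 x y).continuous

theorem Regular.continuous_H (hM : M.Regular c L) (x : X) (y : Y) : Continuous (M.H x y) :=
  continuous_of_norm_sub_le (hM.norm_H_sub_le x y)

theorem Regular.continuous_accept (hM : M.Regular c L) (x : X) (z z' : Fin n) :
    Continuous fun θ => M.accept x θ z z' := by
  simp only [accept_eq_exp]
  have := hM.continuous_sim x (M.neg x z)
  have := hM.continuous_sim x (M.neg x z')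
  fun_prop

end Continuity

section Measurability

variable [Fintype X] [MeasurableSingletonClass X] {α : Type*} [MeasurableSpace α]

theorem IsDataset.measurable_sim (hM : M.IsDataset) (θ : EuclideanSpace ℝ (Fin p)) :
    Measurable fun q : X × Y => M.sim q.1 q.2 θ := by
  refine measurable_from_prod_countable_right fun x => ?_
  have h : Measurable fun _ : Y => M.φ x θ := measurable_const
  exact h.inner (𝕜 := ℝ) (hM.measurable_ψ θ)

/-- Each directional derivative is a pointwise limit of difference quotients with increments `v /
k`, and these are measurable in the pair. -/
theorem Regular.measurable_H (hM : M.Regular c L) (θ : EuclideanSpace ℝ (Fin p)) :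
    Measurable fun q : X × Y => M.H q.1 q.2 θ := by
  have h : ∀ v : EuclideanSpace ℝ (Fin p),
      Measurable fun q : X × Y => inner ℝ (M.H q.1 q.2 θ) v := by
    intro v
    refine measurable_of_tendsto_metrizable (f := fun (k : ℕ) (q : X × Y) =>
      (k : ℝ) * (M.sim q.1 q.2 (θ + (k : ℝ)⁻¹ • v) - M.sim q.1 q.2 θ)) (fun k => ?_) ?_
    · exact ((hM.data.measurable_sim _).sub (hM.data.measurable_sim _)).const_mul _
    · refine tendsto_pi_nhds.2 fun q => ?_
      have := ((hM.lip.1 q.1 q.2) θ).hasFDerivAt.lim v (c := fun k : ℕ => (k : ℝ))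
        (l := Filter.atTop) (by simpa using tendsto_natCast_atTop_atTop)
      rwa [fderiv_apply_eq_inner_gradient] at this
  have e : (fun q : X × Y => M.H q.1 q.2 θ) = fun q => ∑ i,
      (inner ℝ (M.H q.1 q.2 θ) (EuclideanSpace.basisFun (Fin p) ℝ i)) •
        EuclideanSpace.basisFun (Fin p) ℝ i := by
    funext q
    conv_lhs => rw [← (EuclideanSpace.basisFun (Fin p) ℝ).sum_repr' (M.H q.1 q.2 θ)]
    exact Finset.sum_congr rfl fun i _ => by rw [real_inner_comm]
  rw [e]
  exact Finset.measurable_sum _ fun i _ => (h _).smul_const _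

theorem Regular.measurable_uncurry_H (hM : M.Regular c L) :
    Measurable fun a : EuclideanSpace ℝ (Fin p) × (X × Y) => M.H a.2.1 a.2.2 a.1 :=
  measurable_uncurry_of_continuous_of_measurable (u := fun θ (q : X × Y) => M.H q.1 q.2 θ)
    (fun q => hM.continuous_H q.1 q.2) hM.measurable_H

theorem measurable_neg (M : Model X Y p d n) :
    Measurable fun a : X × Fin n => M.neg a.1 a.2 := Measurable.of_discrete

variable {x : α → X} {θ : α → EuclideanSpace ℝ (Fin p)} {z : α → Fin n}

theorem Regular.measurable_uncurry_accept (hM : M.Regular c L) :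
    Measurable fun a : (X × Fin n × Fin n) × EuclideanSpace ℝ (Fin p) =>
      M.accept a.1.1 a.2 a.1.2.1 a.1.2.2 :=
  measurable_from_prod_countable_right fun a => (hM.continuous_accept a.1 a.2.1 a.2.2).measurable

theorem Regular.measurable_mhStep (hM : M.Regular c L) {u : α → Fin n × ℝ} (hx : Measurable x)
    (hθ : Measurable θ) (hz : Measurable z) (hu : Measurable u) :
    Measurable fun a => M.mhStep (x a) (θ a) (z a) (u a) := by
  have h0 := (hx.prodMk (hz.prodMk hu.fst)).prodMk hθ
  have h := hM.measurable_uncurry_accept.comp h0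
  simp only [Function.comp_def, accept] at h
  unfold mhStep
  exact Measurable.ite (measurableSet_le hu.snd h) hu.fst hz

theorem Regular.measurable_mhRun (hM : M.Regular c L) {R : ℕ} {v : α → Fin R → Fin n × ℝ}
    (hx : Measurable x) (hθ : Measurable θ) (hz : Measurable z) (hv : Measurable v) (r : ℕ) :
    Measurable fun a => M.mhRun (x a) (θ a) (z a) (v a) r := by
  induction r with
  | zero => exact hz
  | succ r ih =>
    simp only [mhRun]
    split_ifs with h
    · exact hM.measurable_mhStep hx hθ ih ((measurable_pi_apply _).comp hv)
    · exact ih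

variable {B R : ℕ} {Z : α → X → Fin n}
  {w : α → Fin B → (X × Y) × (Fin R → Fin n × ℝ)}

theorem measurable_apply_of_discrete (hZ : Measurable Z) (hx : Measurable x) :
    Measurable fun a => Z a (x a) :=
  (Measurable.of_discrete (f := fun b : (X → Fin n) × X => b.1 b.2)).comp (hZ.prodMk hx)

variable [DecidableEq X]

theorem measurable_update_of_discrete (hZ : Measurable Z) (hx : Measurable x)
    (hz : Measurable z) : Measurable fun a => Function.update (Z a) (x a) (z a) :=
  (Measurable.of_discrete (f := fun b : (X → Fin n) × X × Fin n =>
    Function.update b.1 b.2.1 b.2.2)).comp (hZ.prodMk (hx.prodMk hz))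

theorem Regular.measurable_chains (hM : M.Regular c L) (hθ : Measurable θ) (hZ : Measurable Z)
    (hw : Measurable w) (k : ℕ) : Measurable fun a => M.chains (θ a) (Z a) (w a) k := by
  induction k with
  | zero => exact hZ
  | succ k ih =>
    simp only [chains]
    split_ifs with h
    · have h1 : Measurable fun a => w a ⟨k, h⟩ := (measurable_pi_apply _).comp hw
      exact measurable_update_of_discrete ih h1.fst.fst
        (hM.measurable_mhRun h1.fst.fst hθ (measurable_apply_of_discrete ih h1.fst.fst) h1.snd R)
    · exact ih

theorem Regular.measurable_sample (hM : M.Regular c L) (hθ : Measurable θ) (hZ : Measurable Z)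
    (hw : Measurable w) (k : Fin B) (r : ℕ) :
    Measurable fun a => M.sample (θ a) (Z a) (w a) k r := by
  have hwk : Measurable fun a => w a k := (measurable_pi_apply k).comp hw
  have h := hM.measurable_mhRun hwk.fst.fst hθ (measurable_apply_of_discrete
    (hM.measurable_chains hθ hZ hw k) hwk.fst.fst) hwk.snd (r + 1)
  unfold sample
  exact M.measurable_neg.comp (hwk.fst.fst.prodMk h)

theorem Regular.measurable_stochGrad (hM : M.Regular c L) (P : ℕ) (hθ : Measurable θ)
    (hZ : Measurable Z) (hw : Measurable w) :
    Measurable fun a => M.stochGrad P (θ a) (Z a) (w a) := by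
  have hwk : ∀ k, Measurable fun a => w a k := fun k => (measurable_pi_apply _).comp hw
  have h0 : ∀ k, Measurable fun a => M.H (w a k).1.1 (w a k).1.2 (θ a) := fun k => by
    have h5 := hM.measurable_uncurry_H.comp (hθ.prodMk (hwk k).fst)
    simp only [Function.comp_def] at h5
    exact h5
  have h1 : Measurable fun a => ∑ k, M.H (w a k).1.1 (w a k).1.2 (θ a) :=
    Finset.measurable_sum _ fun k _ => h0 k
  have h2 : ∀ k r, Measurable fun a =>
      M.H (w a k).1.1 (M.sample (θ a) (Z a) (w a) k r) (θ a) := fun k r => by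
    have h3 := hθ.prodMk ((hwk k).fst.fst.prodMk (hM.measurable_sample hθ hZ hw k r))
    have h5 := hM.measurable_uncurry_H.comp h3
    simp only [Function.comp_def] at h5
    exact h5
  have h4 : Measurable fun a => ∑ k, ∑ r ∈ Finset.Ico P R,
      M.H (w a k).1.1 (M.sample (θ a) (Z a) (w a) k r) (θ a) :=
    Finset.measurable_sum _ fun k _ => Finset.measurable_sum _ fun r _ => h2 k r
  unfold stochGrad
  exact (h1.const_smul (M.β / B)).neg.add (h4.const_smul (M.β / (B * ((R : ℝ) - P))))

theorem Regular.measurable_step (hM : M.Regular c L) (P : ℕ) (γ : ℝ) :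
    Measurable fun a : (EuclideanSpace ℝ (Fin p) × (X → Fin n)) ×
      (Fin B → (X × Y) × (Fin R → Fin n × ℝ)) => M.step P γ a.1 a.2 := by
  have h1 : Measurable fun a : (EuclideanSpace ℝ (Fin p) × (X → Fin n)) ×
      (Fin B → (X × Y) × (Fin R → Fin n × ℝ)) => a.1 := measurable_fst
  have h2 := hM.measurable_stochGrad P h1.fst h1.snd measurable_snd
  exact (h1.fst.sub (h2.const_smul γ)).prodMk
    (hM.measurable_chains h1.fst h1.snd measurable_snd B)

end Measurability

section Noise

variable [NeZero n]

instance : IsProbabilityMeasure (ProbabilityTheory.uniformOn (Set.univ : Set (Fin n))) :=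
  ProbabilityTheory.isProbabilityMeasure_uniformOn Set.finite_univ Set.univ_nonempty

instance : IsProbabilityMeasure ((volume : Measure ℝ).restrict (Set.Icc (0 : ℝ) 1)) :=
  ⟨by simp⟩

theorem IsDataset.isProbabilityMeasure_noise (hM : M.IsDataset) (B R : ℕ) :
    IsProbabilityMeasure (M.noise B R) := by
  have := hM.prob
  unfold noise
  infer_instance

theorem Regular.isProbabilityMeasure_law [Fintype X] [MeasurableSingletonClass X] [DecidableEq X]
    (hM : M.Regular c L) (B R P : ℕ) (γ : ℝ)
    (μ₀ : Measure (EuclideanSpace ℝ (Fin p) × (X → Fin n))) [IsProbabilityMeasure μ₀] (t : ℕ) :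
    IsProbabilityMeasure (M.law B R P γ μ₀ t) := by
  induction t with
  | zero => assumption
  | succ t ih =>
    have := hM.data.isProbabilityMeasure_noise B R
    exact Measure.isProbabilityMeasure_map (hM.measurable_step P γ).aemeasurable

end Noise

end Model

end EMC

/-! ### Expectations over the randomness of one iteration -/

namespace EMC

theorem integrable_of_measurable_of_bound {α : Type*} [MeasurableSpace α] {μ : Measure α}
    [IsFiniteMeasure μ] {E : Type*} [NormedAddCommGroup E] [MeasurableSpace E] [BorelSpace E]
    [SecondCountableTopology E] {f : α → E} {C : ℝ} (hf : Measurable f) (hC : ∀ a, ‖f a‖ ≤ C) :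
    Integrable f μ :=
  Integrable.of_bound hf.aestronglyMeasurable C (Filter.Eventually.of_forall hC)

theorem norm_integral_le_of_bound {α : Type*} [MeasurableSpace α] {μ : Measure α}
    [IsProbabilityMeasure μ] {E : Type*} [NormedAddCommGroup E] [NormedSpace ℝ E]
    {f : α → E} {C : ℝ} (hC : ∀ a, ‖f a‖ ≤ C) : ‖∫ a, f a ∂μ‖ ≤ C := by
  simpa using norm_integral_le_of_norm_le_const (μ := μ) (Filter.Eventually.of_forall hC)

section Resampling

variable {ι α : Type*} [Fintype ι] [DecidableEq ι] [MeasurableSpace α] {μ : Measure α}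
  [IsProbabilityMeasure μ]

/-- Replacing one coordinate by an independent copy preserves the product measure. -/
theorem measurePreserving_update_pi (i : ι) :
    MeasurePreserving (fun a : (ι → α) × α => Function.update a.1 i a.2)
      ((Measure.pi fun _ => μ).prod μ) (Measure.pi fun _ => μ) := by
  have hm : Measurable fun a : (ι → α) × α => Function.update a.1 i a.2 := by
    refine measurable_pi_iff.2 fun j => ?_
    by_cases hj : j = i
    · subst hj
      simpa using measurable_snd
    · simp only [Function.update_of_ne hj]
      exact (measurable_pi_apply j).comp measurable_fst
  refine ⟨hm, (Measure.pi_eq fun s hs => ?_).symm⟩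
  rw [Measure.map_apply hm (MeasurableSet.univ_pi hs)]
  have : (fun a : (ι → α) × α => Function.update a.1 i a.2) ⁻¹' Set.univ.pi s
      = (Set.univ.pi (Function.update s i Set.univ)) ×ˢ (s i) := by
    ext a
    simp only [Set.mem_preimage, Set.mem_univ_pi, Set.mem_prod]
    constructor
    · intro h
      refine ⟨fun j => ?_, by simpa using h i⟩
      by_cases hj : j = i
      · subst hj; simp
      · simpa [Function.update_of_ne hj] using h j
    · rintro ⟨h, hi⟩ j
      by_cases hj : j = i
      · subst hj; simpa using hi
      · simpa [Function.update_of_ne hj] using h j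
  rw [this, Measure.prod_prod, Measure.pi_pi,
    ← Finset.mul_prod_erase Finset.univ _ (Finset.mem_univ i),
    ← Finset.mul_prod_erase Finset.univ (fun j => μ (s j)) (Finset.mem_univ i)]
  simp only [Function.update_self, measure_univ, one_mul]
  rw [mul_comm]
  congr 1
  refine Finset.prod_congr rfl fun j hj => ?_
  rw [Function.update_of_ne (Finset.ne_of_mem_erase hj)]

/-- Plays the role of conditioning on the other coordinates: coordinate `i` is resampled and
integrated out first. -/
theorem integral_pi_eq_integral_update {E : Type*} [NormedAddCommGroup E] [NormedSpace ℝ E]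
    (i : ι) {F : (ι → α) → E} (hF : Integrable F (Measure.pi fun _ => μ)) :
    ∫ w, F w ∂(Measure.pi fun _ => μ)
      = ∫ w, ∫ u, F (Function.update w i u) ∂μ ∂(Measure.pi fun _ => μ) := by
  have h := measurePreserving_update_pi (μ := μ) i
  have hF' : AEStronglyMeasurable F ((((Measure.pi fun _ : ι => μ).prod μ)).map
      fun a : (ι → α) × α => Function.update a.1 i a.2) := by
    rw [h.map_eq]; exact hF.aestronglyMeasurable
  conv_lhs => rw [← h.map_eq]
  rw [integral_map h.measurable.aemeasurable hF']
  exact integral_prod (fun a : (ι → α) × α => F (Function.update a.1 i a.2))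
    ((h.integrable_comp hF.aestronglyMeasurable).2 hF)

end Resampling

namespace Model

variable {X Y : Type*} [MeasurableSpace X] [MeasurableSpace Y] {p d n : ℕ}
  {M : Model X Y p d n} {c L : ℝ} {P B R : ℕ}

/-- The state after `r` steps uses only the inputs with index below `r`. With
`integral_pi_eq_integral_update` this yields the Markov property. -/
theorem mhRun_update (M : Model X Y p d n) (x : X) (θ : EuclideanSpace ℝ (Fin p)) (z : Fin n)
    (v : Fin R → Fin n × ℝ) (i : Fin R) (u : Fin n × ℝ) {r : ℕ} (hr : r ≤ i) :
    M.mhRun x θ z (Function.update v i u) r = M.mhRun x θ z v r := by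
  induction r with
  | zero => rfl
  | succ r ih =>
    have hri : r < i := hr
    have hrR : r < R := hri.trans i.2
    have hne : (⟨r, hrR⟩ : Fin R) ≠ i := fun h => by rw [← h] at hri; exact lt_irrefl _ hri
    simp only [mhRun, hrR, dif_pos, ih hri.le, Function.update_of_ne hne]

theorem chains_update [DecidableEq X] (M : Model X Y p d n) (θ : EuclideanSpace ℝ (Fin p))
    (Z : X → Fin n) (w : Fin B → (X × Y) × (Fin R → Fin n × ℝ)) (i : Fin B)
    (u : (X × Y) × (Fin R → Fin n × ℝ)) {k : ℕ} (hk : k ≤ i) :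
    M.chains θ Z (Function.update w i u) k = M.chains θ Z w k := by
  induction k with
  | zero => rfl
  | succ k ih =>
    have hki : k < i := hk
    have hkB : k < B := hki.trans i.2
    have hne : (⟨k, hkB⟩ : Fin B) ≠ i := fun h => by rw [← h] at hki; exact lt_irrefl _ hki
    simp only [chains, hkB, dif_pos, ih hki.le, Function.update_of_ne hne]

/-- Law of the randomness of `R` Metropolis-Hastings steps. -/
noncomputable def runNoise (n R : ℕ) : Measure (Fin R → Fin n × ℝ) :=
  Measure.pi fun _ => (ProbabilityTheory.uniformOn (Set.univ : Set (Fin n))).prod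
    (volume.restrict (Set.Icc (0 : ℝ) 1))

/-- Law of the randomness used for one element of the mini-batch. -/
noncomputable def pairNoise (M : Model X Y p d n) (R : ℕ) :
    Measure ((X × Y) × (Fin R → Fin n × ℝ)) :=
  M.Dpos.prod (runNoise n R)

theorem noise_eq (M : Model X Y p d n) (B R : ℕ) :
    M.noise B R = Measure.pi fun _ => M.pairNoise R := rfl

theorem integral_uniformOn_univ {E : Type*} [NormedAddCommGroup E] [NormedSpace ℝ E]
    [CompleteSpace E] [NeZero n] (f : Fin n → E) :
    ∫ z, f z ∂(ProbabilityTheory.uniformOn (Set.univ : Set (Fin n))) = (n : ℝ)⁻¹ • ∑ z, f z := by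
  rw [integral_fintype Integrable.of_finite, Finset.smul_sum]
  refine Finset.sum_congr rfl fun z _ => ?_
  rw [Measure.real, ProbabilityTheory.uniformOn_univ]
  simp

theorem integral_ite_le {E : Type*} [NormedAddCommGroup E] [NormedSpace ℝ E]
    [CompleteSpace E] {a : ℝ} (h0 : 0 ≤ a) (h1 : a ≤ 1) (b b' : E) :
    ∫ u, (if u ≤ a then b else b') ∂((volume : Measure ℝ).restrict (Set.Icc (0 : ℝ) 1))
      = a • b + (1 - a) • b' := by
  have e : (fun u : ℝ => if u ≤ a then b else b')
      = fun u => (Set.Iic a).indicator (fun _ => b - b') u + b' := by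
    funext u
    by_cases hu : u ≤ a
    · simp [hu]
    · simp [hu]
  rw [e, integral_add ((integrable_const _).indicator measurableSet_Iic) (integrable_const _),
    integral_indicator measurableSet_Iic, Measure.restrict_restrict measurableSet_Iic]
  have : Set.Iic a ∩ Set.Icc (0 : ℝ) 1 = Set.Icc 0 a := by
    ext u
    simp only [Set.mem_inter_iff, Set.mem_Iic, Set.mem_Icc]
    constructor
    · rintro ⟨h, h', _⟩; exact ⟨h', h⟩
    · rintro ⟨h, h'⟩; exact ⟨h', h, h'.trans h1⟩
  rw [this]
  simp [h0]
  module

section Correction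

variable [Fintype X]

/-- The correction of the parameter which turns the stochastic gradient into an unbiased one. -/
noncomputable def correction (M : Model X Y p d n) (B P R : ℕ) (θ : EuclideanSpace ℝ (Fin p))
    (Z : X → Fin n) : EuclideanSpace ℝ (Fin p) :=
  (M.β / B) • ∑ x, M.chainSol P R x θ (Z x)

theorem correction_update [DecidableEq X] (M : Model X Y p d n) (θ : EuclideanSpace ℝ (Fin p))
    (Z : X → Fin n)
    (x : X) (z : Fin n) :
    M.correction B P R θ (Function.update Z x z) = M.correction B P R θ Z
      + (M.β / B) • (M.chainSol P R x θ z - M.chainSol P R x θ (Z x)) := by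
  rw [correction, correction, ← smul_add]
  congr 1
  rw [← sub_eq_iff_eq_add', ← Finset.sum_sub_distrib]
  rw [Finset.sum_eq_single x (fun y _ hy => by rw [Function.update_of_ne hy, sub_self])
    (fun h => absurd (Finset.mem_univ x) h), Function.update_self]

end Correction

section Steps

variable [NeZero n]

instance : IsProbabilityMeasure (runNoise n R) := by unfold runNoise; infer_instance

theorem IsDataset.isProbabilityMeasure_pairNoise (hM : M.IsDataset) (R : ℕ) :
    IsProbabilityMeasure (M.pairNoise R) := by
  have := hM.prob
  unfold pairNoise
  infer_instance

theorem mhOp_pow_sampleGradient (M : Model X Y p d n) (x : X) (θ : EuclideanSpace ℝ (Fin p))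
    (k : ℕ) (z : Fin n) : (M.mhOp x θ ^ k) (fun j => M.H x (M.neg x j) θ) z
      = (M.mhOp x θ ^ k) (M.centeredH x θ) z + M.meanH x θ := by
  have hn : (n : ℝ) ≠ 0 := natCast_pos_of_neZero.ne'
  have hconst : ∀ j : ℕ, (M.mhOp x θ ^ j) (fun _ => M.meanH x θ) = fun _ => M.meanH x θ := by
    intro j
    induction j with
    | zero => rfl
    | succ j ih =>
      rw [pow_succ', mul_apply_eq_comp, ih]
      funext z
      rw [mhOp_apply]
      simp [← add_smul, ← Nat.cast_smul_eq_nsmul ℝ, smul_smul, hn]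
  have e : (fun j => M.H x (M.neg x j) θ) = M.centeredH x θ + fun _ => M.meanH x θ := by
    funext j
    simp [centeredH]
  rw [e, map_add, hconst]
  rfl

variable [Fintype X]

variable [MeasurableSingletonClass X]

theorem Regular.integral_mhStep (hM : M.Regular c L) (x : X) (θ : EuclideanSpace ℝ (Fin p))
    (z : Fin n) (f : Fin n → EuclideanSpace ℝ (Fin p)) :
    ∫ u, f (M.mhStep x θ z u) ∂((ProbabilityTheory.uniformOn (Set.univ : Set (Fin n))).prod
      (volume.restrict (Set.Icc (0 : ℝ) 1))) = M.mhOp x θ f z := by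
  have hm : Measurable fun u => f (M.mhStep x θ z u) :=
    (Measurable.of_discrete (f := f)).comp
      (hM.measurable_mhStep measurable_const measurable_const measurable_const measurable_id)
  rw [integral_prod _ (integrable_of_measurable_of_bound hm fun u => norm_le_pi_norm f _),
    mhOp_apply, integral_uniformOn_univ]
  congr 1
  refine Finset.sum_congr rfl fun z' _ => ?_
  rw [← integral_ite_le (M.accept_nonneg x θ z z') (M.accept_le_one x θ z z')]
  refine integral_congr_ae (Filter.Eventually.of_forall fun u => ?_)
  simp only [mhStep, accept]
  split_ifs with h <;> simp [h]

/-- The last step is integrated out first and turns `f` into its image under the kernel; hence the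
induction over all `f`. -/
theorem Regular.integral_mhRun (hM : M.Regular c L) (x : X) (θ : EuclideanSpace ℝ (Fin p))
    (z : Fin n) (f : Fin n → EuclideanSpace ℝ (Fin p)) {r : ℕ} (hr : r ≤ R) :
    ∫ v, f (M.mhRun x θ z v r) ∂(runNoise n R) = (M.mhOp x θ ^ r) f z := by
  induction r generalizing f with
  | zero => simp [mhRun]
  | succ r ih =>
    have hm : Measurable fun v : Fin R → Fin n × ℝ => f (M.mhRun x θ z v (r + 1)) :=
      (Measurable.of_discrete (f := f)).comp
        (hM.measurable_mhRun measurable_const measurable_const measurable_const measurable_id _)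
    rw [runNoise, integral_pi_eq_integral_update ⟨r, hr⟩
      (integrable_of_measurable_of_bound hm fun v => norm_le_pi_norm f _), ← runNoise]
    have : ∀ (v : Fin R → Fin n × ℝ) (u : Fin n × ℝ),
        M.mhRun x θ z (Function.update v ⟨r, hr⟩ u) (r + 1)
          = M.mhStep x θ (M.mhRun x θ z v r) u := by
      intro v u
      have hr' : r < R := hr
      simp only [mhRun, hr', dif_pos, Function.update_self]
      rw [M.mhRun_update x θ z v ⟨r, hr⟩ u le_rfl]
    simp only [this, hM.integral_mhStep]
    rw [ih (M.mhOp x θ f) (Nat.le_of_succ_le hr), pow_succ, mul_apply_eq_comp]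

variable [DecidableEq X]

/-- The Poisson equation for the processing of one element of the mini-batch. -/
theorem Regular.integral_run (hM : M.Regular c L) (hPR : P < R) (θ : EuclideanSpace ℝ (Fin p))
    (Z : X → Fin n) (x : X) :
    ∫ v, ((M.β / (B * ((R : ℝ) - P))) • ∑ r ∈ Finset.Ico P R,
        M.H x (M.neg x (M.mhRun x θ (Z x) v (r + 1))) θ
      + M.correction B P R θ (Function.update Z x (M.mhRun x θ (Z x) v R))) ∂(runNoise n R)
      = (M.β / B) • M.meanH x θ + M.correction B P R θ Z := by
  have hd : (0 : ℝ) < (R : ℝ) - P := sub_pos.2 (by exact_mod_cast hPR)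
  have hint : ∀ (f : Fin n → EuclideanSpace ℝ (Fin p)) (r : ℕ),
      Integrable (fun v => f (M.mhRun x θ (Z x) v r)) (runNoise n R) := by
    intro f r
    have hm : Measurable fun v : Fin R → Fin n × ℝ => f (M.mhRun x θ (Z x) v r) :=
      (Measurable.of_discrete (f := f)).comp
        (hM.measurable_mhRun measurable_const measurable_const measurable_const measurable_id _)
    exact integrable_of_measurable_of_bound hm fun v => norm_le_pi_norm f _
  have hH : ∀ r, Integrable (fun v => M.H x (M.neg x (M.mhRun x θ (Z x) v r)) θ) (runNoise n R) :=
    hint fun j => M.H x (M.neg x j) θ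
  have hs := hint (M.chainSol P R x θ) R
  have hA : Integrable (fun v => (M.β / (B * ((R : ℝ) - P))) • ∑ r ∈ Finset.Ico P R,
      M.H x (M.neg x (M.mhRun x θ (Z x) v (r + 1))) θ) (runNoise n R) :=
    Integrable.smul (M.β / (B * ((R : ℝ) - P)))
      (integrable_finsetSum (Finset.Ico P R) fun r _ => hH (r + 1))
  have hC : Integrable (fun v => (M.β / B) • (M.chainSol P R x θ (M.mhRun x θ (Z x) v R)
      - M.chainSol P R x θ (Z x))) (runNoise n R) :=
    Integrable.smul (M.β / B) (hs.sub (integrable_const (M.chainSol P R x θ (Z x))))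
  have hD : Integrable (fun v => M.correction B P R θ Z + (M.β / B) •
      (M.chainSol P R x θ (M.mhRun x θ (Z x) v R) - M.chainSol P R x θ (Z x))) (runNoise n R) :=
    (integrable_const _).add hC
  simp only [correction_update]
  rw [integral_add hA hD,
    integral_add (integrable_const _) hC, integral_smul,
    integral_smul, integral_sub hs (integrable_const _), integral_finsetSum _ fun r _ => hH (r + 1)]
  simp only [integral_const, probReal_univ, one_smul]
  rw [hM.integral_mhRun x θ (Z x) _ le_rfl]
  have h1 : ∀ r ∈ Finset.Ico P R,
      ∫ v, M.H x (M.neg x (M.mhRun x θ (Z x) v (r + 1))) θ ∂(runNoise n R)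
        = (M.mhOp x θ ^ (r + 1)) (M.centeredH x θ) (Z x) + M.meanH x θ := by
    intro r hr
    rw [← mhOp_pow_sampleGradient]
    exact hM.integral_mhRun x θ (Z x) (fun j => M.H x (M.neg x j) θ) (Finset.mem_Ico.1 hr).2
  rw [Finset.sum_congr rfl h1, Finset.sum_add_distrib, Finset.sum_const, Nat.card_Ico,
    ← Nat.cast_smul_eq_nsmul ℝ, Nat.cast_sub hPR.le]
  have h2 := congrFun (M.chainSol_sub_mhOp_pow hPR x θ) (Z x)
  simp only [Pi.sub_apply, Pi.smul_apply, Finset.sum_apply] at h2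
  -- By the Poisson equation the expected change of the solution is minus the averaged bias of the
  -- samples, so only the stationary mean survives.
  have h3 : (M.mhOp x θ ^ R) (M.chainSol P R x θ) (Z x) - M.chainSol P R x θ (Z x)
      = -(((R : ℝ) - P)⁻¹ • ∑ r ∈ Finset.Ico P R,
        (M.mhOp x θ ^ (r + 1)) (M.centeredH x θ) (Z x)) := by
    rw [← h2, neg_sub]
  rw [h3]
  have h4 : M.β / (B * ((R : ℝ) - P)) = M.β / B * ((R : ℝ) - P)⁻¹ := by
    rw [← div_div, div_eq_mul_inv _ ((R : ℝ) - P)]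
  rw [h4, smul_add, smul_smul _ ((R : ℝ) - P), inv_mul_cancel_right₀ hd.ne', smul_neg, smul_smul]
  abel

end Steps

end Model

end EMC

/-! ### The gradient of the loss and the unbiased corrected gradient -/

namespace EMC

namespace Model

variable {X Y : Type*} [MeasurableSpace X] [MeasurableSpace Y] {p d n : ℕ}
  {M : Model X Y p d n} {c L : ℝ} {P B R : ℕ}

section LossMeasurability

variable [Fintype X] [MeasurableSingletonClass X]

theorem Regular.measurable_lossIntegrand (hM : M.Regular c L) (θ : EuclideanSpace ℝ (Fin p)) :
    Measurable fun q : X × Y => Real.log (∑ j, Real.exp (M.β * M.sim q.1 (M.neg q.1 j) θ))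
      - M.β * M.sim q.1 q.2 θ := by
  refine Measurable.sub ?_ ((hM.data.measurable_sim θ).const_mul _)
  exact (Measurable.of_discrete (f := fun x : X =>
    Real.log (∑ j, Real.exp (M.β * M.sim x (M.neg x j) θ)))).comp measurable_fst

theorem measurable_meanH (M : Model X Y p d n) (θ : EuclideanSpace ℝ (Fin p)) :
    Measurable fun q : X × Y => M.meanH q.1 θ :=
  (Measurable.of_discrete (f := fun x : X => M.meanH x θ)).comp measurable_fst

theorem Regular.integrable_H (hM : M.Regular c L) (θ : EuclideanSpace ℝ (Fin p)) :
    Integrable (fun q : X × Y => M.H q.1 q.2 θ) M.Dpos :=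
  have := hM.data.prob
  integrable_of_measurable_of_bound (hM.measurable_H θ) fun q => hM.norm_H_le q.1 q.2 θ

end LossMeasurability

section Loss

variable [NeZero n]

theorem neg_log_softmax (M : Model X Y p d n) (q : X × Y) (θ : EuclideanSpace ℝ (Fin p)) :
    -Real.log (Real.exp (M.β * M.sim q.1 q.2 θ) / ∑ j, Real.exp (M.β * M.sim q.1 (M.neg q.1 j) θ))
      = Real.log (∑ j, Real.exp (M.β * M.sim q.1 (M.neg q.1 j) θ)) - M.β * M.sim q.1 q.2 θ := by
  rw [Real.log_div (Real.exp_pos _).ne' (M.sum_exp_pos q.1 θ).ne', Real.log_exp, neg_sub]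

theorem Regular.abs_log_sum_exp_sub_le (hM : M.Regular c L) (x : X)
    (θ : EuclideanSpace ℝ (Fin p)) :
    |Real.log (∑ j, Real.exp (M.β * M.sim x (M.neg x j) θ)) - Real.log n| ≤ M.β * c ^ 2 := by
  have hn : (0 : ℝ) < n := natCast_pos_of_neZero
  have hβ := hM.β_pos
  have h : ∀ j, -(M.β * c ^ 2) ≤ M.β * M.sim x (M.neg x j) θ ∧
      M.β * M.sim x (M.neg x j) θ ≤ M.β * c ^ 2 := fun j => by
    have := abs_le.1 (hM.abs_sim_le x (M.neg x j) θ)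
    constructor <;> nlinarith
  have h1 : n * Real.exp (-(M.β * c ^ 2)) ≤ ∑ j, Real.exp (M.β * M.sim x (M.neg x j) θ) := by
    have := Finset.card_nsmul_le_sum Finset.univ
      (fun j => Real.exp (M.β * M.sim x (M.neg x j) θ)) (Real.exp (-(M.β * c ^ 2)))
      (fun j _ => Real.exp_le_exp.2 (h j).1)
    simpa using this
  have h2 : ∑ j, Real.exp (M.β * M.sim x (M.neg x j) θ) ≤ n * Real.exp (M.β * c ^ 2) := by
    have := Finset.sum_le_card_nsmul Finset.univ
      (fun j => Real.exp (M.β * M.sim x (M.neg x j) θ)) (Real.exp (M.β * c ^ 2))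
      (fun j _ => Real.exp_le_exp.2 (h j).2)
    simpa using this
  have h3 := Real.log_le_log (by positivity) h1
  have h4 := Real.log_le_log (M.sum_exp_pos x θ) h2
  rw [Real.log_mul hn.ne' (Real.exp_pos _).ne', Real.log_exp] at h3 h4
  exact abs_le.2 ⟨by linarith, by linarith⟩

theorem Regular.hasFDerivAt_log_sum_exp (hM : M.Regular c L) (x : X)
    (θ : EuclideanSpace ℝ (Fin p)) :
    HasFDerivAt (fun θ => Real.log (∑ j, Real.exp (M.β * M.sim x (M.neg x j) θ)))
      (innerSL ℝ (M.β • M.meanH x θ)) θ := by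
  have h1 : ∀ j, HasFDerivAt (M.sim x (M.neg x j)) (innerSL ℝ (M.H x (M.neg x j) θ)) θ :=
    fun j => ((hM.lip.1 x (M.neg x j)) θ).hasGradientAt.hasFDerivAt
  have h2 := (HasFDerivAt.fun_sum (u := Finset.univ) fun j _ =>
    ((h1 j).const_mul M.β).exp).log (M.sum_exp_pos x θ).ne'
  refine h2.congr_fderiv ?_
  ext v
  simp only [smul_apply, sum_apply, innerSL_apply_apply, smul_eq_mul, meanH, inner_smul_left,
    sum_inner, softmax, Finset.mul_sum]
  refine Finset.sum_congr rfl fun j _ => ?_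
  simp only [conj_trivial]
  ring

theorem Regular.abs_lossIntegrand_sub_le (hM : M.Regular c L) (q : X × Y)
    (θ : EuclideanSpace ℝ (Fin p)) :
    |Real.log (∑ j, Real.exp (M.β * M.sim q.1 (M.neg q.1 j) θ)) - M.β * M.sim q.1 q.2 θ
      - Real.log n| ≤ 2 * M.β * c ^ 2 := by
  have hβ := hM.β_pos
  have h1 := abs_le.1 (hM.abs_log_sum_exp_sub_le q.1 θ)
  have h2 := abs_le.1 (hM.abs_sim_le q.1 q.2 θ)
  exact abs_le.2 ⟨by nlinarith, by nlinarith⟩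

variable [Fintype X] [MeasurableSingletonClass X]

theorem Regular.integrable_lossIntegrand (hM : M.Regular c L) (θ : EuclideanSpace ℝ (Fin p)) :
    Integrable (fun q : X × Y => Real.log (∑ j, Real.exp (M.β * M.sim q.1 (M.neg q.1 j) θ))
      - M.β * M.sim q.1 q.2 θ) M.Dpos := by
  have := hM.data.prob
  have h := (integrable_of_measurable_of_bound (μ := M.Dpos)
    ((hM.measurable_lossIntegrand θ).sub_const (Real.log n))
    fun q => hM.abs_lossIntegrand_sub_le q θ).add (integrable_const (Real.log n))
  simpa [Pi.add_def] using h

/-- The loss varies by at most `2 β c²` around `log n`. -/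
theorem Regular.abs_loss_sub_le (hM : M.Regular c L) (θ : EuclideanSpace ℝ (Fin p)) :
    |M.loss θ - Real.log n| ≤ 2 * M.β * c ^ 2 := by
  have := hM.data.prob
  have h : M.loss θ - Real.log n = ∫ q, (Real.log (∑ j, Real.exp (M.β * M.sim q.1 (M.neg q.1 j) θ))
      - M.β * M.sim q.1 q.2 θ - Real.log n) ∂M.Dpos := by
    rw [integral_sub (hM.integrable_lossIntegrand θ) (integrable_const _)]
    simp only [loss, neg_log_softmax, integral_const, probReal_univ, one_smul]
  rw [h, ← Real.norm_eq_abs]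
  exact norm_integral_le_of_bound fun q => hM.abs_lossIntegrand_sub_le q θ

theorem Regular.integrable_meanH (hM : M.Regular c L) (θ : EuclideanSpace ℝ (Fin p)) :
    Integrable (fun q : X × Y => M.meanH q.1 θ) M.Dpos :=
  have := hM.data.prob
  integrable_of_measurable_of_bound (M.measurable_meanH θ) fun q => hM.norm_meanH_le q.1 θ

/-- Differentiation under the integral sign; `gradBound` provides a constant dominating function. -/
theorem Regular.hasGradientAt_loss (hM : M.Regular c L) (θ : EuclideanSpace ℝ (Fin p)) :
    HasGradientAt M.loss
      (M.β • (∫ q, M.meanH q.1 θ ∂M.Dpos - ∫ q, M.H q.1 q.2 θ ∂M.Dpos)) θ := by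
  have := hM.data.prob
  have hβ := hM.β_pos
  let F' : EuclideanSpace ℝ (Fin p) → X × Y → EuclideanSpace ℝ (Fin p) →L[ℝ] ℝ := fun θ q =>
    innerSL ℝ (M.β • (M.meanH q.1 θ - M.H q.1 q.2 θ))
  have hloss : M.loss = fun θ => ∫ q, (Real.log (∑ j, Real.exp (M.β * M.sim q.1 (M.neg q.1 j) θ))
      - M.β * M.sim q.1 q.2 θ) ∂M.Dpos := by
    funext θ
    simp only [loss, neg_log_softmax]
  have hm : Measurable fun q : X × Y => M.β • (M.meanH q.1 θ - M.H q.1 q.2 θ) :=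
    ((M.measurable_meanH θ).sub (hM.measurable_H θ)).const_smul M.β
  have hb : ∀ (θ : EuclideanSpace ℝ (Fin p)) (q : X × Y),
      ‖M.β • (M.meanH q.1 θ - M.H q.1 q.2 θ)‖ ≤ M.β * (2 * gradBound c L) := by
    intro θ q
    rw [norm_smul, Real.norm_eq_abs, abs_of_pos hβ]
    gcongr
    refine (norm_sub_le _ _).trans ?_
    linarith [hM.norm_meanH_le q.1 θ, hM.norm_H_le q.1 q.2 θ]
  have hF'm : AEStronglyMeasurable (F' θ) M.Dpos :=
    (innerSL ℝ).continuous.comp_aestronglyMeasurable hm.aestronglyMeasurable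
  have hF'b : ∀ θ q, ‖F' θ q‖ ≤ M.β * (2 * gradBound c L) := fun θ q => by
    simpa only [F', innerSL_apply_norm] using hb θ q
  have key := hasFDerivAt_integral_of_dominated_of_fderiv_le (μ := M.Dpos) (x₀ := θ)
    (F := fun θ (q : X × Y) => Real.log (∑ j, Real.exp (M.β * M.sim q.1 (M.neg q.1 j) θ))
      - M.β * M.sim q.1 q.2 θ) (F' := F') (bound := fun _ => M.β * (2 * gradBound c L))
    (s := Set.univ) Filter.univ_mem
    (Filter.Eventually.of_forall fun θ => (hM.measurable_lossIntegrand θ).aestronglyMeasurable)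
    (hM.integrable_lossIntegrand θ) hF'm
    (Filter.Eventually.of_forall fun q θ _ => hF'b θ q) (integrable_const _)
    (Filter.Eventually.of_forall fun q θ _ => by
      have h1 : HasFDerivAt (M.sim q.1 q.2) (innerSL ℝ (M.H q.1 q.2 θ)) θ :=
        ((hM.lip.1 q.1 q.2) θ).hasGradientAt.hasFDerivAt
      refine ((hM.hasFDerivAt_log_sum_exp q.1 θ).sub (h1.const_mul M.β)).congr_fderiv ?_
      ext v
      simp only [F', sub_apply, smul_apply, innerSL_apply_apply, smul_eq_mul, inner_smul_left,
        inner_sub_left, conj_trivial]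
      ring)
  rw [hasGradientAt_iff_hasFDerivAt, hloss]
  refine key.congr_fderiv ?_
  have hF'i : Integrable (F' θ) M.Dpos :=
    Integrable.of_bound hF'm _ (Filter.Eventually.of_forall (hF'b θ))
  ext v
  rw [ContinuousLinearMap.integral_apply hF'i]
  have h2 : ∀ q, F' θ q v = inner ℝ v (M.β • (M.meanH q.1 θ - M.H q.1 q.2 θ)) := fun q => by
    simp only [F', innerSL_apply_apply]
    rw [real_inner_comm]
  simp only [h2]
  rw [integral_inner (integrable_of_measurable_of_bound hm (hb θ)), integral_smul,
    integral_sub (hM.integrable_meanH θ) (hM.integrable_H θ), real_inner_comm]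
  rfl

theorem Regular.differentiable_loss (hM : M.Regular c L) : Differentiable ℝ M.loss :=
  fun θ => (hM.hasGradientAt_loss θ).differentiableAt

theorem Regular.gradient_loss (hM : M.Regular c L) (θ : EuclideanSpace ℝ (Fin p)) :
    gradient M.loss θ
      = M.β • (∫ q, M.meanH q.1 θ ∂M.Dpos - ∫ q, M.H q.1 q.2 θ ∂M.Dpos) :=
  (hM.hasGradientAt_loss θ).gradient

theorem Regular.norm_gradient_loss_le (hM : M.Regular c L) (θ : EuclideanSpace ℝ (Fin p)) :
    ‖gradient M.loss θ‖ ≤ 2 * M.β * gradBound c L := by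
  have := hM.data.prob
  have hβ := hM.β_pos
  rw [hM.gradient_loss, norm_smul, Real.norm_eq_abs, abs_of_pos hβ]
  have h1 := norm_integral_le_of_bound (μ := M.Dpos) fun q : X × Y => hM.norm_meanH_le q.1 θ
  have h2 := norm_integral_le_of_bound (μ := M.Dpos) fun q : X × Y => hM.norm_H_le q.1 q.2 θ
  have h3 := norm_sub_le (∫ q, M.meanH q.1 θ ∂M.Dpos) (∫ q, M.H q.1 q.2 θ ∂M.Dpos)
  nlinarith

theorem Regular.norm_gradient_loss_sub_le (hM : M.Regular c L)
    (θ θ' : EuclideanSpace ℝ (Fin p)) :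
    ‖gradient M.loss θ - gradient M.loss θ'‖ ≤ M.β * centeredLip M.β c L * ‖θ - θ'‖ := by
  have := hM.data.prob
  have hβ := hM.β_pos
  have h0 : gradient M.loss θ - gradient M.loss θ'
      = M.β • (∫ q, (M.meanH q.1 θ - M.meanH q.1 θ') ∂M.Dpos
        - ∫ q, (M.H q.1 q.2 θ - M.H q.1 q.2 θ') ∂M.Dpos) := by
    rw [hM.gradient_loss, hM.gradient_loss, ← smul_sub,
      integral_sub (hM.integrable_meanH θ) (hM.integrable_meanH θ'),
      integral_sub (hM.integrable_H θ) (hM.integrable_H θ')]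
    congr 1
    abel
  rw [h0, norm_smul, Real.norm_eq_abs, abs_of_pos hβ, mul_assoc]
  refine mul_le_mul_of_nonneg_left ?_ hβ.le
  have h1 := norm_integral_le_of_bound (μ := M.Dpos)
    fun q : X × Y => hM.norm_meanH_sub_le q.1 θ θ'
  have h2 := norm_integral_le_of_bound (μ := M.Dpos)
    fun q : X × Y => hM.norm_H_sub_le q.1 q.2 θ θ'
  refine (norm_sub_le _ _).trans ((add_le_add h1 h2).trans (le_of_eq ?_))
  rw [centeredLip]
  ring

end Loss

/-- Each of the chains contributes `n / R * s`. The factor carries no exponential because Doeblin's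
constant is `1/n`. -/
theorem norm_correction_le [NeZero n] [Fintype X] (M : Model X Y p d n) (hβ : 0 < M.β) (hPR : P < R)
    (θ : EuclideanSpace ℝ (Fin p)) (Z : X → Fin n) {s : ℝ}
    (hs : ∀ x, ‖M.centeredH x θ‖ ≤ s) :
    ‖M.correction B P R θ Z‖ ≤ M.β * s * (Fintype.card X * n / (B * R)) := by
  rw [correction, norm_smul, Real.norm_eq_abs, abs_of_nonneg (by positivity)]
  have h : ‖∑ x, M.chainSol P R x θ (Z x)‖ ≤ ∑ _x : X, (n : ℝ) / R * s := by
    refine norm_sum_le_of_le _ fun x _ => ?_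
    refine (norm_le_pi_norm _ _).trans ((M.norm_chainSol_le hPR x θ).trans ?_)
    gcongr
    exact hs x
  refine (mul_le_mul_of_nonneg_left h (by positivity)).trans (le_of_eq ?_)
  rw [Finset.sum_const, Finset.card_univ, nsmul_eq_mul]
  ring

theorem Regular.norm_correction_sub_le [NeZero n] [Fintype X] (hM : M.Regular c L) (hB : 0 < B)
    (hPR : P < R)
    (θ θ' : EuclideanSpace ℝ (Fin p)) (Z : X → Fin n) :
    ‖M.correction B P R θ Z - M.correction B P R θ' Z‖
      ≤ M.β * Fintype.card X * solLip n R M.β c * L * ‖θ - θ'‖ := by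
  have hβ := hM.β_pos
  have hL := hM.L_nonneg
  have hB1 : (1 : ℝ) ≤ B := by exact_mod_cast hB
  rw [correction, correction, ← smul_sub, ← Finset.sum_sub_distrib, norm_smul, Real.norm_eq_abs,
    abs_of_nonneg (by positivity)]
  have h : ‖∑ x, (M.chainSol P R x θ (Z x) - M.chainSol P R x θ' (Z x))‖
      ≤ ∑ _x : X, solLip n R M.β c * L * ‖θ - θ'‖ := by
    refine norm_sum_le_of_le _ fun x _ => ?_
    exact (norm_le_pi_norm (M.chainSol P R x θ - M.chainSol P R x θ') (Z x)).trans
      (hM.norm_chainSol_sub_le hPR x θ θ')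
  have h' : M.β / B ≤ M.β := div_le_self hβ.le hB1
  refine (mul_le_mul h' h (norm_nonneg _) hβ.le).trans (le_of_eq ?_)
  rw [Finset.sum_const, Finset.card_univ, nsmul_eq_mul]
  ring

/-- The contribution to the stochastic gradient of the negative samples of one element. -/
noncomputable def negPart (M : Model X Y p d n) (B P : ℕ) (θ : EuclideanSpace ℝ (Fin p))
    (Z : X → Fin n) (u : (X × Y) × (Fin R → Fin n × ℝ)) : EuclideanSpace ℝ (Fin p) :=
  (M.β / (B * ((R : ℝ) - P))) • ∑ r ∈ Finset.Ico P R,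
    M.H u.1.1 (M.neg u.1.1 (M.mhRun u.1.1 θ (Z u.1.1) u.2 (r + 1))) θ

/-- The chain states after the processing of one element. -/
noncomputable def chainStep [DecidableEq X] (M : Model X Y p d n) (θ : EuclideanSpace ℝ (Fin p))
    (Z : X → Fin n)
    (u : (X × Y) × (Fin R → Fin n × ℝ)) : X → Fin n :=
  Function.update Z u.1.1 (M.mhRun u.1.1 θ (Z u.1.1) u.2 R)

theorem chains_succ [DecidableEq X] (M : Model X Y p d n) (θ : EuclideanSpace ℝ (Fin p))
    (Z : X → Fin n)
    (w : Fin B → (X × Y) × (Fin R → Fin n × ℝ)) (k : Fin B) :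
    M.chains θ Z w (k + 1) = M.chainStep θ (M.chains θ Z w k) (w k) := by
  simp only [chains, k.2, dif_pos, chainStep]

theorem stochGrad_eq [DecidableEq X] (M : Model X Y p d n) (θ : EuclideanSpace ℝ (Fin p))
    (Z : X → Fin n)
    (w : Fin B → (X × Y) × (Fin R → Fin n × ℝ)) :
    M.stochGrad P θ Z w = -((M.β / B) • ∑ k, M.H (w k).1.1 (w k).1.2 θ)
      + ∑ k : Fin B, M.negPart B P θ (M.chains θ Z w k) (w k) := by
  rw [stochGrad]
  congr 1
  rw [Finset.smul_sum]
  rfl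

theorem Regular.norm_negPart_le (hM : M.Regular c L) (hPR : P < R) (θ : EuclideanSpace ℝ (Fin p))
    (Z : X → Fin n) (u : (X × Y) × (Fin R → Fin n × ℝ)) :
    ‖M.negPart B P θ Z u‖ ≤ M.β / B * gradBound c L := by
  have hβ := hM.β_pos
  have hd : (0 : ℝ) < (R : ℝ) - P := sub_pos.2 (by exact_mod_cast hPR)
  rw [negPart, norm_smul, Real.norm_eq_abs, abs_of_nonneg (by positivity)]
  have h : ‖∑ r ∈ Finset.Ico P R,
      M.H u.1.1 (M.neg u.1.1 (M.mhRun u.1.1 θ (Z u.1.1) u.2 (r + 1))) θ‖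
      ≤ ∑ _r ∈ Finset.Ico P R, gradBound c L :=
    norm_sum_le_of_le _ fun r _ => hM.norm_H_le _ _ θ
  refine (mul_le_mul_of_nonneg_left h (by positivity)).trans (le_of_eq ?_)
  rw [Finset.sum_const, Nat.card_Ico, nsmul_eq_mul, Nat.cast_sub hPR.le]
  field_simp

theorem Regular.measurable_negPart [Fintype X] [MeasurableSingletonClass X] (hM : M.Regular c L)
    (θ : EuclideanSpace ℝ (Fin p))
    {α : Type*} [MeasurableSpace α] {Z : α → X → Fin n} (hZ : Measurable Z)
    {u : α → (X × Y) × (Fin R → Fin n × ℝ)} (hu : Measurable u) :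
    Measurable fun a => M.negPart B P θ (Z a) (u a) := by
  have h : ∀ r, Measurable fun a =>
      M.H (u a).1.1 (M.neg (u a).1.1 (M.mhRun (u a).1.1 θ (Z a (u a).1.1) (u a).2 (r + 1))) θ := by
    intro r
    have h1 := hu.fst.fst.prodMk (hM.measurable_mhRun hu.fst.fst (measurable_const (a := θ))
      (measurable_apply_of_discrete hZ hu.fst.fst) hu.snd (r + 1))
    have h2 := (Measurable.of_discrete
      (f := fun b : X × Fin n => M.H b.1 (M.neg b.1 b.2) θ)).comp h1
    simp only [Function.comp_def] at h2
    exact h2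
  have h3 : Measurable fun a => ∑ r ∈ Finset.Ico P R,
      M.H (u a).1.1 (M.neg (u a).1.1 (M.mhRun (u a).1.1 θ (Z a (u a).1.1) (u a).2 (r + 1))) θ :=
    Finset.measurable_sum _ fun r _ => h r
  exact h3.const_smul (M.β / (B * ((R : ℝ) - P)))

theorem Regular.norm_correction_le' [NeZero n] [Fintype X] (hM : M.Regular c L) (hPR : P < R)
    (θ : EuclideanSpace ℝ (Fin p)) (Z : X → Fin n) :
    ‖M.correction B P R θ Z‖ ≤ M.β * (2 * gradBound c L) * (Fintype.card X * n / (B * R)) :=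
  M.norm_correction_le hM.β_pos hPR θ Z fun x => hM.norm_centeredH_le x θ

theorem Regular.measurable_chainStep [Fintype X] [MeasurableSingletonClass X] [DecidableEq X]
    (hM : M.Regular c L) (θ : EuclideanSpace ℝ (Fin p))
    (Z : X → Fin n) :
    Measurable fun u : (X × Y) × (Fin R → Fin n × ℝ) => M.chainStep θ Z u :=
  measurable_update_of_discrete measurable_const measurable_fst.fst
    (hM.measurable_mhRun measurable_fst.fst measurable_const
      (measurable_apply_of_discrete measurable_const measurable_fst.fst) measurable_snd R)

theorem Regular.integral_negPart_add_correction [NeZero n] [Fintype X]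
    [MeasurableSingletonClass X] [DecidableEq X] (hM : M.Regular c L) (hPR : P < R)
    (θ : EuclideanSpace ℝ (Fin p)) (Z : X → Fin n) :
    ∫ u, (M.negPart B P θ Z u + M.correction B P R θ (M.chainStep θ Z u)) ∂(M.pairNoise R)
      = (M.β / B) • ∫ q, M.meanH q.1 θ ∂M.Dpos + M.correction B P R θ Z := by
  have := hM.data.prob
  have hm : Measurable fun u : (X × Y) × (Fin R → Fin n × ℝ) =>
      M.negPart B P θ Z u + M.correction B P R θ (M.chainStep θ Z u) :=
    (hM.measurable_negPart θ measurable_const measurable_id).add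
      ((Measurable.of_discrete (f := M.correction B P R θ)).comp (hM.measurable_chainStep θ Z))
  rw [pairNoise, integral_prod _ (integrable_of_measurable_of_bound hm fun u =>
    (norm_add_le _ _).trans (add_le_add (hM.norm_negPart_le hPR θ Z u)
      (hM.norm_correction_le' hPR θ _)))]
  simp only [negPart, chainStep]
  simp only [hM.integral_run hPR θ Z]
  have h : Integrable (fun q : X × Y => (M.β / B) • M.meanH q.1 θ) M.Dpos :=
    Integrable.smul (M.β / B) (hM.integrable_meanH θ)
  rw [integral_add h (integrable_const _), integral_smul]
  simp

/-- The stochastic gradient becomes unbiased after the correction by the Poisson equation. -/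
theorem Regular.integral_stochGrad_add_correction [NeZero n] [Fintype X]
    [MeasurableSingletonClass X] [DecidableEq X] (hM : M.Regular c L) (hB : 0 < B) (hPR : P < R)
    (θ : EuclideanSpace ℝ (Fin p)) (Z : X → Fin n) :
    ∫ w, (M.stochGrad P θ Z w + M.correction B P R θ (M.chains θ Z w B)) ∂(M.noise B R)
      = gradient M.loss θ + M.correction B P R θ Z := by
  have := hM.data.prob
  have := hM.data.isProbabilityMeasure_pairNoise R
  have hBR : (B : ℝ) ≠ 0 := by exact_mod_cast hB.ne'
  have hchains : ∀ k, Measurable fun w : Fin B → (X × Y) × (Fin R → Fin n × ℝ) =>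
      M.chains θ Z w k :=
    fun k => hM.measurable_chains measurable_const measurable_const measurable_id k
  -- The negative part of one batch element plus the increment of the correction that it causes. The
  -- states before element `k` do not depend on its noise, so its mean can be taken with those
  -- states frozen.
  let Φ : (X → Fin n) → (X × Y) × (Fin R → Fin n × ℝ) → EuclideanSpace ℝ (Fin p) := fun Z u =>
    (M.negPart B P θ Z u + M.correction B P R θ (M.chainStep θ Z u)) - M.correction B P R θ Z
  have hΦ : ∀ k : Fin B, Integrable (fun w : Fin B → (X × Y) × (Fin R → Fin n × ℝ) =>
      Φ (M.chains θ Z w k) (w k)) (M.noise B R) := by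
    intro k
    have h1 : Measurable fun w : Fin B → (X × Y) × (Fin R → Fin n × ℝ) =>
        M.negPart B P θ (M.chains θ Z w k) (w k) :=
      hM.measurable_negPart θ (hchains k) (measurable_pi_apply k)
    have h2 : Measurable fun w : Fin B → (X × Y) × (Fin R → Fin n × ℝ) =>
        M.correction B P R θ (M.chainStep θ (M.chains θ Z w k) (w k)) := by
      simp only [← chains_succ]
      exact (Measurable.of_discrete (f := M.correction B P R θ)).comp (hchains _)
    have h3 : Measurable fun w : Fin B → (X × Y) × (Fin R → Fin n × ℝ) =>
        M.correction B P R θ (M.chains θ Z w k) :=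
      (Measurable.of_discrete (f := M.correction B P R θ)).comp (hchains k)
    rw [noise_eq]
    exact integrable_of_measurable_of_bound ((h1.add h2).sub h3) fun w =>
      (norm_sub_le _ _).trans (add_le_add ((norm_add_le _ _).trans
        (add_le_add (hM.norm_negPart_le hPR θ _ _) (hM.norm_correction_le' hPR θ _)))
        (hM.norm_correction_le' hPR θ _))
  have hΦi : ∀ k : Fin B, ∫ w, Φ (M.chains θ Z w k) (w k) ∂(M.noise B R)
      = (M.β / B) • ∫ q, M.meanH q.1 θ ∂M.Dpos := by
    intro k
    have h := hΦ k
    rw [noise_eq] at h ⊢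
    rw [integral_pi_eq_integral_update k h]
    simp only [M.chains_update θ Z _ k _ le_rfl, Function.update_self]
    have h1 : ∀ Z, ∫ u, Φ Z u ∂(M.pairNoise R) = (M.β / B) • ∫ q, M.meanH q.1 θ ∂M.Dpos := by
      intro Z
      have hm : Measurable fun u : (X × Y) × (Fin R → Fin n × ℝ) =>
          M.negPart B P θ Z u + M.correction B P R θ (M.chainStep θ Z u) :=
        (hM.measurable_negPart θ measurable_const measurable_id).add
          ((Measurable.of_discrete (f := M.correction B P R θ)).comp (hM.measurable_chainStep θ Z))
      simp only [Φ]
      rw [integral_sub (integrable_of_measurable_of_bound hm fun u =>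
        (norm_add_le _ _).trans (add_le_add (hM.norm_negPart_le hPR θ Z u)
        (hM.norm_correction_le' hPR θ _))) (integrable_const _),
        hM.integral_negPart_add_correction hPR]
      simp
    simp [h1]
  have hpos : ∀ k : Fin B, MeasurePreserving (fun w : Fin B → (X × Y) × (Fin R → Fin n × ℝ) =>
      (w k).1) (M.noise B R) M.Dpos := by
    intro k
    rw [noise_eq]
    exact (measurePreserving_fst (μ := M.Dpos) (ν := runNoise n R)).comp
      (measurePreserving_eval (fun _ : Fin B => M.pairNoise R) k)
  have hHi : ∀ k : Fin B, Integrable (fun w : Fin B → (X × Y) × (Fin R → Fin n × ℝ) =>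
      M.H (w k).1.1 (w k).1.2 θ) (M.noise B R) := fun k =>
    ((hpos k).integrable_comp (hM.integrable_H θ).aestronglyMeasurable).2 (hM.integrable_H θ)
  have hH : ∀ k : Fin B, ∫ w, M.H (w k).1.1 (w k).1.2 θ ∂(M.noise B R)
      = ∫ q, M.H q.1 q.2 θ ∂M.Dpos := by
    intro k
    have h := (hM.integrable_H θ).aestronglyMeasurable
    rw [← (hpos k).map_eq] at h
    have h' := integral_map (hpos k).measurable.aemeasurable h
    rw [(hpos k).map_eq] at h'
    exact h'.symm
  -- The increments of the correction telescope over the batch.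
  have key : ∀ w : Fin B → (X × Y) × (Fin R → Fin n × ℝ),
      M.stochGrad P θ Z w + M.correction B P R θ (M.chains θ Z w B)
        = -((M.β / B) • ∑ k, M.H (w k).1.1 (w k).1.2 θ)
          + (∑ k : Fin B, Φ (M.chains θ Z w k) (w k) + M.correction B P R θ Z) := by
    intro w
    have htel : ∑ k : Fin B, (M.correction B P R θ (M.chains θ Z w (k + 1))
        - M.correction B P R θ (M.chains θ Z w k))
        = M.correction B P R θ (M.chains θ Z w B) - M.correction B P R θ Z := by
      rw [Fin.sum_univ_eq_sum_range (fun k => M.correction B P R θ (M.chains θ Z w (k + 1))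
        - M.correction B P R θ (M.chains θ Z w k)) B,
        Finset.sum_range_sub (fun k => M.correction B P R θ (M.chains θ Z w k))]
      rfl
    have hsum : ∑ k : Fin B, Φ (M.chains θ Z w k) (w k)
        = ∑ k : Fin B, M.negPart B P θ (M.chains θ Z w k) (w k)
          + (M.correction B P R θ (M.chains θ Z w B) - M.correction B P R θ Z) := by
      rw [← htel, ← Finset.sum_add_distrib]
      refine Finset.sum_congr rfl fun k _ => ?_
      rw [chains_succ]
      exact add_sub_assoc _ _ _
    rw [stochGrad_eq, hsum]
    abel
  have hprob := hM.data.isProbabilityMeasure_noise B R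
  simp only [key]
  have hA : Integrable (fun w : Fin B → (X × Y) × (Fin R → Fin n × ℝ) =>
      -((M.β / B) • ∑ k, M.H (w k).1.1 (w k).1.2 θ)) (M.noise B R) :=
    (Integrable.smul (M.β / B : ℝ) (integrable_finsetSum Finset.univ fun k _ => hHi k)).neg
  have hS : Integrable (fun w : Fin B → (X × Y) × (Fin R → Fin n × ℝ) =>
      ∑ k : Fin B, Φ (M.chains θ Z w k) (w k)) (M.noise B R) :=
    integrable_finsetSum Finset.univ fun k _ => hΦ k
  have hT : Integrable (fun w : Fin B → (X × Y) × (Fin R → Fin n × ℝ) =>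
      ∑ k : Fin B, Φ (M.chains θ Z w k) (w k) + M.correction B P R θ Z) (M.noise B R) :=
    hS.add (integrable_const _)
  rw [integral_add hA hT, integral_add hS (integrable_const _),
    integral_neg, integral_smul, integral_finsetSum _ fun k _ => hHi k,
    integral_finsetSum _ fun k _ => hΦ k]
  simp only [hH, hΦi, integral_const, probReal_univ, one_smul, Finset.sum_const, Finset.card_univ,
    Fintype.card_fin, ← Nat.cast_smul_eq_nsmul ℝ]
  rw [hM.gradient_loss, smul_smul, smul_smul, div_mul_cancel₀ _ hBR, mul_div_cancel₀ _ hBR,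
    smul_sub]
  abel

end Model

end EMC

/-! ### The Lyapunov function and its decrease -/

namespace EMC

namespace Model

variable {X Y : Type*} [MeasurableSpace X] [MeasurableSpace Y] {p d n : ℕ}
  {M : Model X Y p d n} {c L σ γ : ℝ} {P B R : ℕ}
  [NeZero n] [Fintype X] [MeasurableSingletonClass X]

theorem Regular.continuous_gradient_loss (hM : M.Regular c L) : Continuous (gradient M.loss) :=
  continuous_of_norm_sub_le hM.norm_gradient_loss_sub_le

theorem Regular.measurable_loss (hM : M.Regular c L) :
    Measurable fun s : EuclideanSpace ℝ (Fin p) × (X → Fin n) => M.loss s.1 :=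
  hM.differentiable_loss.continuous.measurable.comp measurable_fst

/-- The loss corrected by the solution of the Poisson equation. -/
noncomputable def lyapunov (M : Model X Y p d n) (B P R : ℕ) (γ : ℝ)
    (s : EuclideanSpace ℝ (Fin p) × (X → Fin n)) : ℝ :=
  M.loss s.1 - γ * inner ℝ (gradient M.loss s.1) (M.correction B P R s.1 s.2)

theorem Regular.measurable_inner_correction (hM : M.Regular c L) (hB : 0 < B) (hPR : P < R) :
    Measurable fun s : EuclideanSpace ℝ (Fin p) × (X → Fin n) =>
      (inner ℝ (gradient M.loss s.1) (M.correction B P R s.1 s.2) : ℝ) := by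
  refine measurable_from_prod_countable_left fun Z => Continuous.measurable ?_
  exact hM.continuous_gradient_loss.inner
    (continuous_of_norm_sub_le fun θ θ' => hM.norm_correction_sub_le hB hPR θ θ' Z)

variable {μ : Measure (EuclideanSpace ℝ (Fin p) × (X → Fin n))} [IsProbabilityMeasure μ]

theorem Regular.integrable_loss (hM : M.Regular c L) : Integrable (fun s => M.loss s.1) μ :=
  integrable_of_measurable_of_bound hM.measurable_loss
    (C := 2 * M.β * c ^ 2 + |Real.log n|) fun s => by
      have h := (abs_sub_abs_le_abs_sub (M.loss s.1) (Real.log n)).trans (hM.abs_loss_sub_le s.1)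
      rw [Real.norm_eq_abs]
      linarith

theorem Regular.integrable_sq_gradient (hM : M.Regular c L) :
    Integrable (fun s => ‖gradient M.loss s.1‖ ^ 2) μ :=
  integrable_of_measurable_of_bound
    ((hM.continuous_gradient_loss.norm.pow 2).measurable.comp measurable_fst)
    (C := (2 * M.β * gradBound c L) ^ 2) fun s => by
      rw [Real.norm_eq_abs, abs_of_nonneg (by positivity)]
      exact pow_le_pow_left₀ (norm_nonneg _) (hM.norm_gradient_loss_le s.1) 2

theorem Regular.abs_inner_correction_le (hM : M.Regular c L) (hPR : P < R)
    (hσ0 : 0 ≤ σ) (hσ : M.BoundedGradientNoise σ)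
    (s : EuclideanSpace ℝ (Fin p) × (X → Fin n)) :
    |inner ℝ (gradient M.loss s.1) (M.correction B P R s.1 s.2)|
      ≤ 2 * M.β * gradBound c L * (2 * M.β * σ * (Fintype.card X * n / (B * R))) := by
  have hβ := hM.β_pos
  have hg := gradBound_nonneg c L
  refine (abs_real_inner_le_norm _ _).trans ?_
  have h := M.norm_correction_le (B := B) hβ hPR s.1 s.2
    fun x => norm_centeredH_le_of_noise hσ0 ((hσ s.1).2 x)
  rw [show M.β * (2 * σ) = 2 * M.β * σ by ring] at h
  exact mul_le_mul (hM.norm_gradient_loss_le s.1) h (norm_nonneg _) (by positivity)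

theorem Regular.integrable_inner_correction (hM : M.Regular c L) (hB : 0 < B) (hPR : P < R)
    (hσ0 : 0 ≤ σ) (hσ : M.BoundedGradientNoise σ) :
    Integrable (fun s => (inner ℝ (gradient M.loss s.1) (M.correction B P R s.1 s.2) : ℝ)) μ :=
  integrable_of_measurable_of_bound (hM.measurable_inner_correction hB hPR) fun s => by
    rw [Real.norm_eq_abs]
    exact hM.abs_inner_correction_le hPR hσ0 hσ s

theorem Regular.measurable_lyapunov (hM : M.Regular c L) (hB : 0 < B) (hPR : P < R) :
    Measurable (M.lyapunov B P R γ) :=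
  hM.measurable_loss.sub ((hM.measurable_inner_correction hB hPR).const_mul γ)

theorem Regular.abs_lyapunov_le (hM : M.Regular c L) (hPR : P < R) (hγ : 0 < γ)
    (hσ0 : 0 ≤ σ) (hσ : M.BoundedGradientNoise σ)
    (s : EuclideanSpace ℝ (Fin p) × (X → Fin n)) :
    ‖M.lyapunov B P R γ s‖ ≤ 2 * M.β * c ^ 2 + |Real.log n|
      + γ * (2 * M.β * gradBound c L * (2 * M.β * σ * (Fintype.card X * n / (B * R)))) := by
  have h1 := (abs_sub_abs_le_abs_sub (M.loss s.1) (Real.log n)).trans (hM.abs_loss_sub_le s.1)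
  have h2 := hM.abs_inner_correction_le (B := B) hPR hσ0 hσ s
  rw [lyapunov]
  refine (norm_sub_le _ _).trans (add_le_add ?_ ?_)
  · rw [Real.norm_eq_abs]
    linarith
  · rw [norm_mul, Real.norm_eq_abs, Real.norm_eq_abs, abs_of_pos hγ]
    exact mul_le_mul_of_nonneg_left h2 hγ.le

variable [DecidableEq X]

/-- The stochastic gradient deviates from the gradient by at most `2 β σ`. -/
theorem Regular.ae_norm_stochGrad_sub_le (hM : M.Regular c L) (hσ : M.BoundedGradientNoise σ)
    (hB : 0 < B) (hPR : P < R) (θ : EuclideanSpace ℝ (Fin p)) (Z : X → Fin n) :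
    ∀ᵐ w ∂(M.noise B R), ‖M.stochGrad P θ Z w - gradient M.loss θ‖ ≤ 2 * M.β * σ := by
  have := hM.data.prob
  have := hM.data.isProbabilityMeasure_pairNoise R
  have hβ := hM.β_pos
  have hBR : (0 : ℝ) < B := by exact_mod_cast hB
  have hd : (0 : ℝ) < (R : ℝ) - P := sub_pos.2 (by exact_mod_cast hPR)
  set a := ∫ q, M.H q.1 q.2 θ ∂M.Dpos with ha
  set b := ∫ q, M.meanH q.1 θ ∂M.Dpos with hb
  have hpos : ∀ᵐ w ∂(M.noise B R), ∀ k : Fin B, ‖M.H (w k).1.1 (w k).1.2 θ - a‖ ≤ σ := by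
    refine ae_all_iff.2 fun k => ?_
    have hmp : MeasurePreserving (fun w : Fin B → (X × Y) × (Fin R → Fin n × ℝ) => (w k).1)
        (M.noise B R) M.Dpos :=
      (measurePreserving_fst (μ := M.Dpos) (ν := runNoise n R)).comp
        (measurePreserving_eval (fun _ : Fin B => M.pairNoise R) k)
    exact hmp.quasiMeasurePreserving.ae (hσ θ).1
  filter_upwards [hpos] with w hw
  -- For negatives the noise bound holds at every index, so no null set arises and the law of the
  -- chain states is irrelevant here.
  have hneg : ∀ k r, ‖M.H (w k).1.1 (M.sample θ Z w k r) θ - b‖ ≤ σ := fun k r => (hσ θ).2 _ _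
  have e : M.stochGrad P θ Z w - gradient M.loss θ
      = -((M.β / B) • ∑ k, (M.H (w k).1.1 (w k).1.2 θ - a)) + (M.β / (B * ((R : ℝ) - P))) •
        ∑ k, ∑ r ∈ Finset.Ico P R, (M.H (w k).1.1 (M.sample θ Z w k r) θ - b) := by
    rw [hM.gradient_loss, stochGrad, ← ha, ← hb]
    simp only [Finset.sum_sub_distrib, Finset.sum_const, Finset.card_univ, Fintype.card_fin,
      Nat.card_Ico, ← Nat.cast_smul_eq_nsmul ℝ, smul_sub, smul_smul, Nat.cast_sub hPR.le]
    rw [div_mul_cancel₀ _ hBR.ne', div_mul_cancel₀ _ (mul_pos hBR hd).ne']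
    abel
  have h1 : ‖∑ k, (M.H (w k).1.1 (w k).1.2 θ - a)‖ ≤ B * σ := by
    refine (norm_sum_le_of_le Finset.univ fun k _ => hw k).trans (le_of_eq ?_)
    simp
  have h2 : ‖∑ k, ∑ r ∈ Finset.Ico P R, (M.H (w k).1.1 (M.sample θ Z w k r) θ - b)‖
      ≤ B * (((R : ℝ) - P) * σ) := by
    refine (norm_sum_le_of_le Finset.univ fun k _ =>
      norm_sum_le_of_le (Finset.Ico P R) fun r _ => hneg k r).trans (le_of_eq ?_)
    simp [Nat.cast_sub hPR.le]
  rw [e]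
  refine (norm_add_le _ _).trans ?_
  rw [norm_neg, norm_smul, norm_smul, Real.norm_eq_abs, Real.norm_eq_abs,
    abs_of_nonneg (by positivity), abs_of_nonneg (by positivity)]
  refine (add_le_add (mul_le_mul_of_nonneg_left h1 (by positivity))
    (mul_le_mul_of_nonneg_left h2 (by positivity))).trans (le_of_eq ?_)
  field_simp
  ring

/-- The decrease of the Lyapunov function along one step of the algorithm. -/
theorem Regular.integral_lyapunov_step_le (hM : M.Regular c L) (hB : 0 < B) (hPR : P < R)
    (hγ : 0 < γ) (hσ0 : 0 ≤ σ) (hσ : M.BoundedGradientNoise σ)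
    (s : EuclideanSpace ℝ (Fin p) × (X → Fin n)) {N e K₀ ℓ Λ : ℝ}
    (hN : N = ‖gradient M.loss s.1‖) (he : e = 2 * M.β * σ)
    (hK₀ : K₀ = Fintype.card X * n / (B * R)) (hℓ : ℓ = M.β * centeredLip M.β c L)
    (hΛ : Λ = M.β * Fintype.card X * solLip n R M.β c * L) :
    ∫ w, M.lyapunov B P R γ (M.step P γ s w) ∂(M.noise B R)
      ≤ M.lyapunov B P R γ s - γ * N ^ 2
        + γ ^ 2 * (ℓ * (N + e) ^ 2 + ℓ * (N + e) * (e * K₀) + N * (Λ * (N + e))) := by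
  obtain ⟨θ, Z⟩ := s
  have hβ := hM.β_pos
  have hL := hM.L_nonneg
  have hprob := hM.data.isProbabilityMeasure_noise B R
  have hℓ0 : 0 ≤ ℓ := by rw [hℓ, centeredLip]; positivity
  have hΛ0 : 0 ≤ Λ := by rw [hΛ, solLip]; positivity
  have hN0 : 0 ≤ N := hN ▸ norm_nonneg _
  have he0 : 0 ≤ e := by rw [he]; positivity
  set D := γ ^ 2 * (ℓ * (N + e) ^ 2 + ℓ * (N + e) * (e * K₀) + N * (Λ * (N + e))) with hD
  let G : (Fin B → (X × Y) × (Fin R → Fin n × ℝ)) → EuclideanSpace ℝ (Fin p) := fun w =>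
    M.stochGrad P θ Z w + M.correction B P R θ (M.chains θ Z w B)
  have hGm : Measurable G := by
    refine Measurable.add (hM.measurable_stochGrad P measurable_const measurable_const
      measurable_id) ?_
    exact (Measurable.of_discrete (f := M.correction B P R θ)).comp
      (hM.measurable_chains measurable_const measurable_const measurable_id B)
  have hcorr : ∀ θ Z, ‖M.correction B P R θ Z‖ ≤ e * K₀ := fun θ Z => by
    rw [he, hK₀, show 2 * M.β * σ = M.β * (2 * σ) by ring]
    exact M.norm_correction_le hβ hPR θ Z fun x => norm_centeredH_le_of_noise hσ0 ((hσ θ).2 x)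
  have hnoise := hM.ae_norm_stochGrad_sub_le hσ hB hPR θ Z
  rw [← he] at hnoise
  have hsg : ∀ᵐ w ∂(M.noise B R), ‖M.stochGrad P θ Z w‖ ≤ N + e := by
    filter_upwards [hnoise] with w hw
    have h := norm_add_le (gradient M.loss θ) (M.stochGrad P θ Z w - gradient M.loss θ)
    rw [add_sub_cancel] at h
    have hN' : N = ‖gradient M.loss θ‖ := hN
    linarith
  have hGi : Integrable G (M.noise B R) := by
    refine Integrable.of_bound hGm.aestronglyMeasurable (N + e + e * K₀) ?_
    filter_upwards [hsg] with w hw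
    exact (norm_add_le _ _).trans (add_le_add hw (hcorr _ _))
  have hpt : ∀ᵐ w ∂(M.noise B R), M.lyapunov B P R γ (M.step P γ (θ, Z) w)
      ≤ M.loss θ + D - γ * inner ℝ (gradient M.loss θ) (G w) := by
    filter_upwards [hsg] with w hg
    set g := M.stochGrad P θ Z w with hgdef
    set Z' := M.chains θ Z w B with hZ'
    set θ' := θ - γ • g with hθ'
    have hstep : M.step P γ (θ, Z) w = (θ', Z') := rfl
    have hdiff : θ' - θ = -(γ • g) := by rw [hθ']; abel
    have hdn : ‖θ' - θ‖ ≤ γ * (N + e) := by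
      rw [hdiff, norm_neg, norm_smul, Real.norm_eq_abs, abs_of_pos hγ]
      exact mul_le_mul_of_nonneg_left hg hγ.le
    have hdesc := abs_taylor_gradient_le hℓ0 hM.differentiable_loss
      (fun x y => by rw [hℓ]; exact hM.norm_gradient_loss_sub_le x y) θ θ'
    have hdesc' := (abs_le.1 hdesc).2
    rw [hdiff, inner_neg_right, inner_smul_right, ← hdiff] at hdesc'
    have hq : ℓ * ‖θ' - θ‖ ^ 2 ≤ ℓ * (γ * (N + e)) ^ 2 := by gcongr
    -- The difference is split so that the Lipschitz constant `Λ` of the correction meets `N`. No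
    -- pure `e ^ 2` term then carries `Λ`, and `remainder_le` can absorb it.
    have hcross : inner ℝ (gradient M.loss θ) (M.correction B P R θ Z')
        - inner ℝ (gradient M.loss θ') (M.correction B P R θ' Z')
        ≤ ℓ * (γ * (N + e)) * (e * K₀) + N * (Λ * (γ * (N + e))) := by
      have e1 : inner ℝ (gradient M.loss θ) (M.correction B P R θ Z')
          - inner ℝ (gradient M.loss θ') (M.correction B P R θ' Z')
          = inner ℝ (gradient M.loss θ - gradient M.loss θ') (M.correction B P R θ' Z')
            + inner ℝ (gradient M.loss θ)
              (M.correction B P R θ Z' - M.correction B P R θ' Z') := by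
        rw [inner_sub_left, inner_sub_right]; ring
      rw [e1]
      refine add_le_add ((real_inner_le_norm _ _).trans ?_) ((real_inner_le_norm _ _).trans ?_)
      · refine mul_le_mul ?_ (hcorr _ _) (norm_nonneg _) (by positivity)
        rw [norm_sub_rev]
        refine (hM.norm_gradient_loss_sub_le θ' θ).trans ?_
        rw [← hℓ]
        gcongr
      · rw [← show N = ‖gradient M.loss θ‖ from hN]
        refine mul_le_mul_of_nonneg_left ?_ hN0
        rw [norm_sub_rev]
        refine (hM.norm_correction_sub_le hB hPR θ' θ Z').trans ?_
        rw [← hΛ]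
        gcongr
    have hcross' := mul_le_mul_of_nonneg_left hcross hγ.le
    have hG : inner ℝ (gradient M.loss θ) (G w) = inner ℝ (gradient M.loss θ) g
        + inner ℝ (gradient M.loss θ) (M.correction B P R θ Z') := inner_add_right _ _ _
    rw [hstep, lyapunov, hG]
    simp only
    rw [hD]
    linarith
  have hint : Integrable (fun w => M.lyapunov B P R γ (M.step P γ (θ, Z) w)) (M.noise B R) := by
    have h0 := (hM.measurable_step (B := B) (R := R) P γ).comp
      (measurable_const.prodMk measurable_id (f := fun _ => ((θ, Z) :
        EuclideanSpace ℝ (Fin p) × (X → Fin n))))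
    have h1 := (hM.measurable_lyapunov (γ := γ) hB hPR).comp h0
    exact integrable_of_measurable_of_bound h1 fun w => hM.abs_lyapunov_le hPR hγ hσ0 hσ _
  have hGin : Integrable (fun w => (inner ℝ (gradient M.loss θ) (G w) : ℝ)) (M.noise B R) :=
    hGi.const_inner _
  refine (integral_mono_ae hint ((integrable_const _).sub (hGin.const_mul γ)) hpt).trans
    (le_of_eq ?_)
  have h2 : Integrable (fun w => γ * (inner ℝ (gradient M.loss θ) (G w) : ℝ)) (M.noise B R) :=
    hGin.const_mul γ
  rw [integral_sub' (integrable_const _) h2, integral_const_mul, integral_inner hGi,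
    hM.integral_stochGrad_add_correction hB hPR, inner_add_right, real_inner_self_eq_norm_sq]
  simp only [integral_const, probReal_univ, one_smul, lyapunov]
  rw [← show N = ‖gradient M.loss θ‖ from hN]
  ring

/-- Absorption of the higher order terms of the one step estimate. -/
theorem remainder_le {γ N e K₀ ℓ Λ : ℝ} (hγ : 0 < γ)
    (hℓ : 0 ≤ ℓ) (h1 : γ * (2 * ℓ + Λ) ≤ 1 / 4)
    (h2 : 2 * γ * (ℓ * K₀ ^ 2) ≤ 1) (h3 : 2 * γ * Λ ^ 2 ≤ ℓ) :
    -(γ * N ^ 2) + γ ^ 2 * (ℓ * (N + e) ^ 2 + ℓ * (N + e) * (e * K₀) + N * (Λ * (N + e)))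
      ≤ -(γ / 2 * N ^ 2) + γ ^ 2 * (ℓ * e ^ 2 * (4 + K₀)) := by
  have a1 : ℓ * (N + e) ^ 2 ≤ ℓ * (2 * N ^ 2 + 2 * e ^ 2) :=
    mul_le_mul_of_nonneg_left (by nlinarith [sq_nonneg (N - e)]) hℓ
  -- The two cross terms cost `N ^ 2 / 8` each and the quadratic ones `N ^ 2 / 4` by `h1`, so half
  -- of `N ^ 2` remains.
  have young : ∀ a : ℝ, γ * (N * a) ≤ N ^ 2 / 8 + 2 * (γ * a) ^ 2 := fun a => by
    nlinarith [sq_nonneg (N / 2 - 2 * (γ * a))]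
  have a2 : γ * (N * (ℓ * e * K₀)) ≤ N ^ 2 / 8 + γ * (ℓ * e ^ 2) := by
    refine (young _).trans ?_
    have : 2 * (γ * (ℓ * e * K₀)) ^ 2 = γ * (ℓ * e ^ 2) * (2 * γ * (ℓ * K₀ ^ 2)) := by ring
    rw [this]
    have := mul_le_mul_of_nonneg_left h2 (show 0 ≤ γ * (ℓ * e ^ 2) by positivity)
    linarith
  have a3 : γ * (N * (Λ * e)) ≤ N ^ 2 / 8 + γ * (ℓ * e ^ 2) := by
    refine (young _).trans ?_
    have : 2 * (γ * (Λ * e)) ^ 2 = γ * e ^ 2 * (2 * γ * Λ ^ 2) := by ring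
    rw [this]
    have := mul_le_mul_of_nonneg_left h3 (show 0 ≤ γ * e ^ 2 by positivity)
    linarith
  have a4 := mul_le_mul_of_nonneg_right h1 (sq_nonneg N)
  have key : -N ^ 2 + γ * (ℓ * (N + e) ^ 2 + ℓ * (N + e) * (e * K₀) + N * (Λ * (N + e)))
      ≤ -(N ^ 2 / 2) + γ * (ℓ * e ^ 2 * (4 + K₀)) := by
    have := mul_le_mul_of_nonneg_left a1 hγ.le
    linarith
  have := mul_le_mul_of_nonneg_left key hγ.le
  linarith

theorem Regular.integral_lyapunov_law_succ_le (hM : M.Regular c L) (hB : 0 < B) (hPR : P < R)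
    (hγ : 0 < γ) (hσ0 : 0 ≤ σ) (hσ : M.BoundedGradientNoise σ) {K₀ ℓ Λ : ℝ}
    (hK₀ : K₀ = Fintype.card X * n / (B * R)) (hℓ : ℓ = M.β * centeredLip M.β c L)
    (hΛ : Λ = M.β * Fintype.card X * solLip n R M.β c * L)
    (h1 : γ * (2 * ℓ + Λ) ≤ 1 / 4) (h2 : 2 * γ * (ℓ * K₀ ^ 2) ≤ 1) (h3 : 2 * γ * Λ ^ 2 ≤ ℓ)
    (t : ℕ) :
    ∫ s, M.lyapunov B P R γ s ∂(M.law B R P γ μ (t + 1))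
      ≤ ∫ s, M.lyapunov B P R γ s ∂(M.law B R P γ μ t)
        - γ / 2 * ∫ s, ‖gradient M.loss s.1‖ ^ 2 ∂(M.law B R P γ μ t)
        + γ ^ 2 * (ℓ * (2 * M.β * σ) ^ 2 * (4 + K₀)) := by
  have hβ := hM.β_pos
  have hL := hM.L_nonneg
  have hprob := hM.data.isProbabilityMeasure_noise B R
  have hlaw := hM.isProbabilityMeasure_law B R P γ μ t
  have hℓ0 : 0 ≤ ℓ := by rw [hℓ, centeredLip]; positivity
  have hV := hM.measurable_lyapunov (γ := γ) hB hPR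
  have hVs := hV.comp (hM.measurable_step (B := B) (R := R) P γ)
  have hVi : Integrable (M.lyapunov B P R γ) (M.law B R P γ μ t) :=
    integrable_of_measurable_of_bound hV fun s => hM.abs_lyapunov_le hPR hγ hσ0 hσ s
  have hVsi : Integrable (fun a : (EuclideanSpace ℝ (Fin p) × (X → Fin n)) ×
      (Fin B → (X × Y) × (Fin R → Fin n × ℝ)) => M.lyapunov B P R γ (M.step P γ a.1 a.2))
      ((M.law B R P γ μ t).prod (M.noise B R)) :=
    integrable_of_measurable_of_bound hVs fun a => hM.abs_lyapunov_le hPR hγ hσ0 hσ _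
  have hg : Integrable (fun s => γ / 2 * ‖gradient M.loss s.1‖ ^ 2) (M.law B R P γ μ t) :=
    hM.integrable_sq_gradient.const_mul _
  rw [law, integral_map (hM.measurable_step P γ).aemeasurable hV.aestronglyMeasurable,
    integral_prod _ hVsi, ← integral_const_mul, ← integral_sub hVi hg]
  have hpt : ∀ s, ∫ w, M.lyapunov B P R γ (M.step P γ s w) ∂(M.noise B R)
      ≤ (M.lyapunov B P R γ s - γ / 2 * ‖gradient M.loss s.1‖ ^ 2)
        + γ ^ 2 * (ℓ * (2 * M.β * σ) ^ 2 * (4 + K₀)) := by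
    intro s
    have ha := hM.integral_lyapunov_step_le hB hPR hγ hσ0 hσ s rfl rfl hK₀ hℓ hΛ
    have hb := remainder_le (N := ‖gradient M.loss s.1‖) (e := 2 * M.β * σ) hγ hℓ0 h1 h2 h3
    linarith
  refine (integral_mono hVsi.integral_prod_left ((hVi.sub hg).add (integrable_const _))
    hpt).trans (le_of_eq ?_)
  rw [integral_add' (hVi.sub hg) (integrable_const _)]
  simp

/-- The averaged squared gradient norm for sufficiently small step sizes. -/
theorem Regular.avgSqGrad_le (hM : M.Regular c L) (hB : 0 < B) (hPR : P < R)
    (hγ : 0 < γ) (hσ0 : 0 ≤ σ) (hσ : M.BoundedGradientNoise σ) {K₀ ℓ Λ : ℝ}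
    (hK₀ : K₀ = Fintype.card X * n / (B * R)) (hℓ : ℓ = M.β * centeredLip M.β c L)
    (hΛ : Λ = M.β * Fintype.card X * solLip n R M.β c * L)
    (h1 : γ * (2 * ℓ + Λ) ≤ 1 / 4) (h2 : 2 * γ * (ℓ * K₀ ^ 2) ≤ 1) (h3 : 2 * γ * Λ ^ 2 ≤ ℓ)
    {T : ℕ} (hT : 1 ≤ T) :
    M.avgSqGrad B R P γ μ T ≤ 2 * M.lossGap B R P γ μ T / (γ * T)
      + 16 * M.β ^ 2 * gradBound c L * σ * K₀ / T
      + 2 * γ * (ℓ * (2 * M.β * σ) ^ 2 * (4 + K₀)) := by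
  have hTpos : (0 : ℝ) < T := by exact_mod_cast hT
  have hstep := hM.integral_lyapunov_law_succ_le (μ := μ) hB hPR hγ hσ0 hσ hK₀ hℓ hΛ h1 h2 h3
  set D := ℓ * (2 * M.β * σ) ^ 2 * (4 + K₀) with hD
  have hsum : ∀ T : ℕ, γ / 2 * ∑ t ∈ Finset.range T,
      ∫ s, ‖gradient M.loss s.1‖ ^ 2 ∂(M.law B R P γ μ t)
      ≤ ∫ s, M.lyapunov B P R γ s ∂(M.law B R P γ μ 0)
        - ∫ s, M.lyapunov B P R γ s ∂(M.law B R P γ μ T) + T * (γ ^ 2 * D) := by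
    intro T
    induction T with
    | zero => simp
    | succ T ih =>
      rw [Finset.sum_range_succ, mul_add]
      have := hstep T
      push_cast
      linarith
  have hprob := hM.isProbabilityMeasure_law B R P γ μ
  have hVint : ∀ t, ∫ s, M.lyapunov B P R γ s ∂(M.law B R P γ μ t)
      = ∫ s, M.loss s.1 ∂(M.law B R P γ μ t) - γ * ∫ s, (inner ℝ (gradient M.loss s.1)
        (M.correction B P R s.1 s.2) : ℝ) ∂(M.law B R P γ μ t) := by
    intro t
    have := hprob t
    have hc : Integrable (fun s => γ * (inner ℝ (gradient M.loss s.1)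
        (M.correction B P R s.1 s.2) : ℝ)) (M.law B R P γ μ t) :=
      (hM.integrable_inner_correction hB hPR hσ0 hσ).const_mul γ
    simp only [lyapunov]
    rw [integral_sub hM.integrable_loss hc, integral_const_mul]
  set b := 2 * M.β * gradBound c L * (2 * M.β * σ * K₀) with hb
  -- After telescoping the correction matters only at times `0` and `T`, which costs `2 * γ * b`.
  have hbound : ∀ t, |∫ s, (inner ℝ (gradient M.loss s.1)
      (M.correction B P R s.1 s.2) : ℝ) ∂(M.law B R P γ μ t)| ≤ b := by
    intro t
    have := hprob t
    rw [← Real.norm_eq_abs]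
    refine norm_integral_le_of_bound fun s => ?_
    rw [Real.norm_eq_abs, hb, hK₀]
    exact hM.abs_inner_correction_le hPR hσ0 hσ s
  have hfin := hsum T
  rw [hVint, hVint] at hfin
  have hb0 := mul_le_mul_of_nonneg_left (abs_le.1 (hbound 0)).1 hγ.le
  have hbT := mul_le_mul_of_nonneg_left (abs_le.1 (hbound T)).2 hγ.le
  have hgap : M.lossGap B R P γ μ T = ∫ s, M.loss s.1 ∂(M.law B R P γ μ 0)
      - ∫ s, M.loss s.1 ∂(M.law B R P γ μ T) := rfl
  have hfin' : γ / 2 * ∑ t ∈ Finset.range T,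
      ∫ s, ‖gradient M.loss s.1‖ ^ 2 ∂(M.law B R P γ μ t)
      ≤ M.lossGap B R P γ μ T + 2 * γ * b + T * (γ ^ 2 * D) := by
    rw [hgap]
    linarith
  have hc : (0 : ℝ) ≤ 2 / (γ * T) := by positivity
  have := mul_le_mul_of_nonneg_left hfin' hc
  rw [avgSqGrad]
  refine (le_of_eq ?_).trans (this.trans (le_of_eq ?_))
  · field_simp
  · rw [hb]
    field_simp
    ring

/-- The loss stays within `2 * β * c ^ 2` of `log n` at every parameter, whatever the step size. -/
theorem Regular.lossGap_le (hM : M.Regular c L) (B R P T : ℕ) (γ : ℝ) :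
    M.lossGap B R P γ μ T ≤ 4 * c ^ 2 * M.β := by
  have h : ∀ t, |∫ s, M.loss s.1 ∂(M.law B R P γ μ t) - Real.log n| ≤ 2 * M.β * c ^ 2 := by
    intro t
    have := hM.isProbabilityMeasure_law B R P γ μ t
    have e : ∫ s, M.loss s.1 ∂(M.law B R P γ μ t) - Real.log n
        = ∫ s, (M.loss s.1 - Real.log n) ∂(M.law B R P γ μ t) := by
      rw [integral_sub hM.integrable_loss (integrable_const _)]
      simp
    rw [e, ← Real.norm_eq_abs]
    exact norm_integral_le_of_bound fun s => hM.abs_loss_sub_le s.1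
  rw [lossGap]
  have h0 := (abs_le.1 (h 0)).2
  have hT := (abs_le.1 (h T)).1
  linarith

end Model

end EMC

/-! ### Step size thresholds and the explicit error bound -/

namespace EMC

namespace Model

/-- The reciprocal of the horizon-free step size threshold. -/
noncomputable def invStep (m n B R : ℕ) (c β L : ℝ) : ℝ :=
  -- Each summand forces one of the conclusions of `step_conditions`.
  1 + 4 * (2 * (β * centeredLip β c L) + β * m * solLip n R β c * L)
    + 2 * (β * centeredLip β c L * (m * n / (B * R)) ^ 2)
    + (β * m * solLip n R β c) ^ 2 * L / β + 2 * β * gradBound c L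

/-- The constant of the part of the error bound which the mixing of the chains does not control. -/
noncomputable def horizonConst (c β L σ : ℝ) : ℝ := 1024 * β ^ 2 * σ * L * (1 + c ^ 2 * β)

theorem centeredLip_nonneg {β c L : ℝ} (hβ : 0 < β) (hL : 0 ≤ L) : 0 ≤ centeredLip β c L := by
  unfold centeredLip
  positivity

theorem solLip_nonneg {n R : ℕ} {β c : ℝ} (hβ : 0 < β) : 0 ≤ solLip n R β c := by
  unfold solLip
  positivity

theorem one_le_invStep (m n B R : ℕ) {c β L : ℝ} (hβ : 0 < β) (hL : 0 ≤ L) :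
    1 ≤ invStep m n B R c β L := by
  have h1 := centeredLip_nonneg (c := c) hβ hL
  have h2 := solLip_nonneg (n := n) (R := R) (c := c) hβ
  have h3 := gradBound_nonneg c L
  have : 0 ≤ 4 * (2 * (β * centeredLip β c L) + β * m * solLip n R β c * L)
    + 2 * (β * centeredLip β c L * (m * n / (B * R)) ^ 2)
    + (β * m * solLip n R β c) ^ 2 * L / β + 2 * β * gradBound c L := by positivity
  unfold invStep
  linarith

/-- The conditions on the step size which enter the error bound. -/
theorem step_conditions {m n B R : ℕ} {c β L γ : ℝ} (hβ : 0 < β) (hL : 0 ≤ L) (hγ : 0 < γ)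
    (h : γ ≤ (invStep m n B R c β L)⁻¹) :
    γ ≤ 1 ∧ γ * (2 * (β * centeredLip β c L) + β * m * solLip n R β c * L) ≤ 1 / 4 ∧
    2 * γ * (β * centeredLip β c L * (m * n / (B * R)) ^ 2) ≤ 1 ∧
    2 * γ * (β * m * solLip n R β c * L) ^ 2 ≤ β * centeredLip β c L ∧
    γ * (2 * β * gradBound c L) ≤ 1 := by
  have h0 := one_le_invStep m n B R (c := c) hβ hL
  have h1 := centeredLip_nonneg (c := c) hβ hL
  have h2 := solLip_nonneg (n := n) (R := R) (c := c) hβ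
  have h3 := gradBound_nonneg c L
  have hγ1 : γ * invStep m n B R c β L ≤ 1 := by
    rwa [← le_div_iff₀ (by linarith), one_div]
  have b1 : 0 ≤ γ * (2 * (β * centeredLip β c L) + β * m * solLip n R β c * L) := by positivity
  have b2 : 0 ≤ γ * (β * centeredLip β c L * (m * n / (B * R)) ^ 2) := by positivity
  have b3 : 0 ≤ γ * ((β * m * solLip n R β c) ^ 2 * L / β) := by positivity
  have b4 : 0 ≤ γ * (2 * β * gradBound c L) := by positivity
  rw [invStep] at hγ1
  have e : ∀ a b d e : ℝ, γ * (1 + 4 * a + 2 * b + d + e)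
      = γ + 4 * (γ * a) + 2 * (γ * b) + γ * d + γ * e := fun a b d e => by ring
  rw [e] at hγ1
  refine ⟨by linarith, by linarith, by linarith, ?_, by linarith⟩
  have b5 : γ * ((β * m * solLip n R β c) ^ 2 * L / β) ≤ 1 := by linarith
  rw [mul_div_assoc', div_le_one hβ] at b5
  -- One factor `L` of the squared constant is paid by `centeredLip`, the other by `b5`. Nothing is
  -- divided by `L`, so `L = 0` needs no separate case.
  have b6 : 2 * L ≤ centeredLip β c L := by
    rw [centeredLip]
    have : 0 ≤ L * (32 * β * c ^ 2) := by positivity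
    linarith
  calc 2 * γ * (β * m * solLip n R β c * L) ^ 2
      = (γ * ((β * m * solLip n R β c) ^ 2 * L)) * (2 * L) := by ring
    _ ≤ β * centeredLip β c L := mul_le_mul b5 b6 (by positivity) hβ.le

variable {X Y : Type*} [MeasurableSpace X] [MeasurableSpace Y] {p d n : ℕ}
  {M : Model X Y p d n} {c L σ γ : ℝ} {P B R : ℕ}
  [NeZero n] [Fintype X] [MeasurableSingletonClass X] [DecidableEq X]
  {μ : Measure (EuclideanSpace ℝ (Fin p) × (X → Fin n))} [IsProbabilityMeasure μ]

/-- The error bound with half of the constant of the initial mixing term. -/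
theorem Regular.avgSqGrad_le_mixing (hM : M.Regular c L) (hB : 0 < B) (hPR : P < R)
    (hγ : 0 < γ) (hσ0 : 0 ≤ σ) (hσ : M.BoundedGradientNoise σ) {K : ℝ}
    (hK : K = Fintype.card X * n * Real.exp (2 * c ^ 2 * M.β) / (B * R))
    (h : γ ≤ (invStep (Fintype.card X) n B R c M.β L)⁻¹) {T : ℕ} (hT : 1 ≤ T) :
    M.avgSqGrad B R P γ μ T ≤ 2 * M.lossGap B R P γ μ T / (γ * T)
      + 12 * M.β * σ * K / (γ * T)
      + γ * M.β ^ 3 * σ ^ 2 * (L * (1024 * (1 + c ^ 2 * M.β) + 256 * K)) := by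
  have hβ := hM.β_pos
  have hL := hM.L_nonneg
  have hTpos : (0 : ℝ) < T := by exact_mod_cast hT
  obtain ⟨-, h1, h2, h3, h4⟩ := step_conditions hβ hL hγ h
  refine (hM.avgSqGrad_le hB hPR hγ hσ0 hσ rfl rfl rfl h1 h2 h3 hT).trans ?_
  set K₀ : ℝ := Fintype.card X * n / (B * R) with hK₀
  have hK₀0 : 0 ≤ K₀ := by positivity
  have hKK : K = K₀ * Real.exp (2 * c ^ 2 * M.β) := by rw [hK, hK₀]; ring
  have hq0 : 0 ≤ c ^ 2 * M.β := by positivity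
  -- The exponential in `K` serves to absorb the factor `1 + c ^ 2 * β` from the smoothness of the
  -- loss.
  have hqexp : 1 + c ^ 2 * M.β ≤ Real.exp (2 * c ^ 2 * M.β) := by
    have := Real.add_one_le_exp (2 * c ^ 2 * M.β)
    linarith
  have hqK : K₀ * (1 + c ^ 2 * M.β) ≤ K := by
    rw [hKK]; exact mul_le_mul_of_nonneg_left hqexp hK₀0
  have hK₀K : K₀ ≤ K := le_trans (by nlinarith) hqK
  -- The condition `h4` trades the gradient bound for `1 / γ`, leaving the constant `8`, below the
  -- available `12`.
  have ha : 16 * M.β ^ 2 * gradBound c L * σ * K₀ / T ≤ 12 * M.β * σ * K / (γ * T) := by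
    rw [div_le_div_iff₀ hTpos (by positivity)]
    have e1 : 16 * M.β ^ 2 * gradBound c L * σ * K₀ * (γ * T)
        = (γ * (2 * M.β * gradBound c L)) * (8 * M.β * σ * K₀ * T) := by ring
    rw [e1]
    have e2 : 8 * M.β * σ * K₀ * T ≤ 8 * M.β * σ * K * T := by gcongr
    have e3 : 0 ≤ M.β * σ * K * T := by
      have := hK₀0.trans hK₀K
      positivity
    have e4 := mul_le_mul_of_nonneg_right h4 (show 0 ≤ 8 * M.β * σ * K₀ * T by positivity)
    linarith
  have hb : 2 * γ * (M.β * centeredLip M.β c L * (2 * M.β * σ) ^ 2 * (4 + K₀))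
      ≤ γ * M.β ^ 3 * σ ^ 2 * (L * (1024 * (1 + c ^ 2 * M.β) + 256 * K)) := by
    have e1 : 2 * γ * (M.β * centeredLip M.β c L * (2 * M.β * σ) ^ 2 * (4 + K₀))
        = γ * M.β ^ 3 * σ ^ 2 * (L * (8 * (2 + 32 * (c ^ 2 * M.β)) * (4 + K₀))) := by
      rw [centeredLip]; ring
    rw [e1]
    refine mul_le_mul_of_nonneg_left (mul_le_mul_of_nonneg_left ?_ hL) (by positivity)
    -- With `q = c ^ 2 * β`, the terms of `8 * (2 + 32 * q) * (4 + K₀)` containing `K₀` are at most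
    -- `256 * K₀ * (1 + q)`, hence at most `256 * K`; the others are at most `1024 * (1 + q)`.
    nlinarith
  linarith

end Model

end EMC

/-! ### Choice of the thresholds and conclusion -/

theorem theorem1 :
    ∃ C : ℝ, 0 < C ∧
    ∀ (m mneg B R : ℕ) (c β L_P L_H σ : ℝ),
      1 ≤ B → 1 ≤ R → 0 < c → 0 < β → 0 ≤ L_P → 0 ≤ L_H → 0 ≤ σ →
    -- `γT T` is the step size threshold for the horizon `T`; `γ₀` does not depend on `T`
    ∃ γT : ℕ → ℝ, (∀ T, 0 < γT T) ∧ ∃ γ₀ : ℝ, 0 < γ₀ ∧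
    ∀ (X Y : Type*) [Fintype X] [DecidableEq X] [MeasurableSpace X] [MeasurableSingletonClass X]
      [MeasurableSpace Y] (p d : ℕ) (M : EMC.Model X Y p d mneg),
      Fintype.card X = m → M.β = β → M.IsDataset →
      M.BoundedEmbeddings c → M.LipschitzSimilarity L_P →
      M.LipschitzSampleGradient L_H → M.BoundedGradientNoise σ →
    ∀ (P : ℕ), P < R →
    ∀ (μ₀ : MeasureTheory.Measure (EuclideanSpace ℝ (Fin p) × (X → Fin mneg)))
      [MeasureTheory.IsProbabilityMeasure μ₀] (γ : ℝ), 0 < γ →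
      -- the quantities below are well defined
      Differentiable ℝ M.loss ∧
      (∀ t : ℕ, MeasureTheory.IsProbabilityMeasure (M.law B R P γ μ₀ t) ∧
        MeasureTheory.Integrable (fun s => M.loss s.1) (M.law B R P γ μ₀ t) ∧
        MeasureTheory.Integrable (fun s => ‖gradient M.loss s.1‖ ^ 2) (M.law B R P γ μ₀ t)) ∧
      ∀ T : ℕ, 1 ≤ T →
        M.lossGap B R P γ μ₀ T ≤ 4 * c ^ 2 * β ∧
        (γ ≤ γT T →
          M.avgSqGrad B R P γ μ₀ T ≤
            2 * M.lossGap B R P γ μ₀ T / (γ * T)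
            + 24 * β * σ * m * mneg * Real.exp (2 * c ^ 2 * β) / (γ * B * R * T)
            + γ * β ^ 3 * σ ^ 2 *
              (C * (L_H * (m * mneg * Real.exp (2 * c ^ 2 * β) / (B * R))
                + L_P * 2 ^ R * m ^ 2 * mneg ^ 2 * Real.exp (6 * c ^ 2 * β) / (B * R ^ 2)))) ∧
        (γ ≤ γ₀ →
          M.avgSqGrad B R P γ μ₀ T ≤
            2 * M.lossGap B R P γ μ₀ T / (γ * T)
            + 24 * β * σ * m * mneg * Real.exp (2 * c ^ 2 * β) / (γ * B * R * T)
            + γ * β ^ 3 * σ ^ 2 *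
              (C * (L_H * max (m * mneg * Real.exp (2 * c ^ 2 * β) / (B * R)) (1 + c ^ 2 * β)
                + L_P * 2 ^ R * m ^ 2 * mneg ^ 2 * Real.exp (6 * c ^ 2 * β) / (B * R ^ 2)))) := by
  -- `1280 = 1024 + 256`, the two constants of `Regular.avgSqGrad_le_mixing`.
  refine ⟨1280, by norm_num, ?_⟩
  intro m n B R c β L_P L_H σ hB hR hc hβ hLP hLH hσ0
  have hBpos : (0 : ℝ) < B := by exact_mod_cast hB
  have hRpos : (0 : ℝ) < R := by exact_mod_cast hR
  set K : ℝ := m * n * Real.exp (2 * c ^ 2 * β) / (B * R) with hKdef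
  have hinv := EMC.Model.one_le_invStep m n B R (c := c) hβ hLH
  have hhor : 0 ≤ EMC.Model.horizonConst c β L_H σ := by
    unfold EMC.Model.horizonConst
    positivity
  have hthr : ∀ T : ℕ, 0 < 1 + T * EMC.Model.horizonConst c β L_H σ := fun T => by positivity
  -- The second entry of the minimum gives `γ * T * horizonConst ≤ 12 * K`. The thresholds precede
  -- the model, so `m` or `n` may still be zero; the default `1` keeps the threshold positive when
  -- `K = 0`.
  refine ⟨fun T => min (EMC.Model.invStep m n B R c β L_H)⁻¹
    (if 0 < K then 12 * K / (1 + T * EMC.Model.horizonConst c β L_H σ) else 1), fun T => ?_,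
    (EMC.Model.invStep m n B R c β L_H)⁻¹, by positivity, ?_⟩
  · refine lt_min (by positivity) ?_
    split_ifs with h
    · exact div_pos (by linarith) (hthr T)
    · exact one_pos
  intro X Y _ _ _ _ _ p d M hcard hMβ hdata hbdd _ hlip hnoise P hPR μ₀ _ γ hγ
  subst hMβ
  subst hcard
  have hM : M.Regular c L_H := ⟨hdata, hβ, hLH, hbdd, hlip⟩
  have hX : Nonempty X := by
    have := hdata.prob
    exact (MeasureTheory.nonempty_of_isProbabilityMeasure M.Dpos).map Prod.fst
  -- The initial law is a probability measure, so some family of chain states exists; as `X` is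
  -- nonempty, `Fin n` has an element.
  have hn : NeZero n := by
    obtain ⟨s⟩ := MeasureTheory.nonempty_of_isProbabilityMeasure μ₀
    obtain ⟨x⟩ := hX
    exact ⟨fun h => (Fin.cast h (s.2 x)).elim0⟩
  have hKpos : 0 < K := by
    have h1 : (0 : ℝ) < n := EMC.Model.natCast_pos_of_neZero
    have h2 : (0 : ℝ) < Fintype.card X := by exact_mod_cast Fintype.card_pos
    positivity
  refine ⟨hM.differentiable_loss, fun t => ?_, fun T hT => ⟨hM.lossGap_le B R P T γ, ?_, ?_⟩⟩
  · have := hM.isProbabilityMeasure_law B R P γ μ₀ t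
    exact ⟨this, hM.integrable_loss, hM.integrable_sq_gradient⟩
  all_goals
    have hTpos : (0 : ℝ) < T := by exact_mod_cast hT
    have hmix : 24 * M.β * σ * Fintype.card X * n * Real.exp (2 * c ^ 2 * M.β) / (γ * B * R * T)
        = 24 * M.β * σ * K / (γ * T) := by
      rw [hKdef]
      field_simp
    have hJ : 0 ≤ L_P * 2 ^ R * (Fintype.card X : ℝ) ^ 2 * (n : ℝ) ^ 2
        * Real.exp (6 * c ^ 2 * M.β) / (B * R ^ 2) := by positivity
    set J := L_P * 2 ^ R * (Fintype.card X : ℝ) ^ 2 * (n : ℝ) ^ 2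
        * Real.exp (6 * c ^ 2 * M.β) / (B * R ^ 2) with hJdef
    have hA : 0 ≤ γ * M.β ^ 3 * σ ^ 2 := by positivity
    have hmixpos : 0 ≤ 12 * M.β * σ * K / (γ * T) := by positivity
    have hmix2 : 24 * M.β * σ * K / (γ * T)
        = 12 * M.β * σ * K / (γ * T) + 12 * M.β * σ * K / (γ * T) := by ring
    intro hγT
    rw [hmix, hmix2]
  · beta_reduce at hγT
    rw [if_pos hKpos] at hγT
    have hγ0 := hγT.trans (min_le_left _ _)
    have hγ1 := hγT.trans (min_le_right _ _)
    rw [le_div_iff₀ (hthr T)] at hγ1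
    have hγle := (EMC.Model.step_conditions hβ hLH hγ hγ0).1
    have hmain := hM.avgSqGrad_le_mixing (μ := μ₀) hB hPR hγ hσ0 hnoise hKdef hγ0 hT
    -- The part not controlled by mixing fits into the unused half of the initial mixing term, since
    -- `γ ≤ 1` and `γ * T * horizonConst ≤ 12 * K`.
    have hext : γ * M.β ^ 3 * σ ^ 2 * (L_H * (1024 * (1 + c ^ 2 * M.β)))
        ≤ 12 * M.β * σ * K / (γ * T) := by
      rw [le_div_iff₀ (by positivity)]
      have e : γ * M.β ^ 3 * σ ^ 2 * (L_H * (1024 * (1 + c ^ 2 * M.β))) * (γ * T)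
          = γ * (γ * (T * EMC.Model.horizonConst c M.β L_H σ)) * (M.β * σ) := by
        rw [EMC.Model.horizonConst]; ring
      rw [e]
      have h1 : γ * (T * EMC.Model.horizonConst c M.β L_H σ) ≤ 12 * K := by linarith
      have h2 : γ * (γ * (T * EMC.Model.horizonConst c M.β L_H σ)) ≤ 1 * (12 * K) :=
        mul_le_mul hγle h1 (by positivity) zero_le_one
      have h3 := mul_le_mul_of_nonneg_right h2 (show 0 ≤ M.β * σ by positivity)
      linarith
    have hJ' : γ * M.β ^ 3 * σ ^ 2 * (L_H * (256 * K))
        ≤ γ * M.β ^ 3 * σ ^ 2 * (1280 * (L_H * K + J)) := by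
      refine mul_le_mul_of_nonneg_left ?_ hA
      nlinarith [mul_nonneg hLH hKpos.le]
    linarith
  · have hmain := hM.avgSqGrad_le_mixing (μ := μ₀) hB hPR hγ hσ0 hnoise hKdef hγT hT
    -- Here no spare term depends on `T`; both parts are instead bounded by the maximum.
    have hJ' : γ * M.β ^ 3 * σ ^ 2 * (L_H * (1024 * (1 + c ^ 2 * M.β) + 256 * K))
        ≤ γ * M.β ^ 3 * σ ^ 2 * (1280 * (L_H * max K (1 + c ^ 2 * M.β) + J)) := by
      refine mul_le_mul_of_nonneg_left ?_ hA
      have h1 := mul_le_mul_of_nonneg_left (le_max_left K (1 + c ^ 2 * M.β)) hLH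
      have h2 := mul_le_mul_of_nonneg_left (le_max_right K (1 + c ^ 2 * M.β)) hLH
      linarith
    linarith
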